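/- Let $n,r\ge 1$, let $k$ be a field and $V$ an $r$-dimensional $k$-vector space. Let $\mathcal F$ be the set of $n$-step flags $0=V_0\subseteq V_1\subseteq\cdots\subseteq V_n=V$ (equalities allowed), with $\mathrm{GL}(V)$ acting on $\mathcal F$ and diagonally on $\mathcal F\times\mathcal F$; let $f_1+f_2$ be the flag with steps $(f_1)_i+(f_2)_i$. The orbit of $(f,f')$, where $f=(V_i)$ and $f'=(V_i')$, is labelled by the $n\times n$ matrix $A=A(f,f')$ of non-negative integers with sum $r$, $$A_{ij}=\dim\bigl(V_{i-1}+(V_i\cap V'_j)\bigr)-\dim\bigl(V_{i-1}+(V_i\cap V'_{j-1})\bigr).$$ For labels $A,A',A''$ let $g_{A,A',A''}\in\mathbb Z[q]$ be the (Beilinson–Lusztig–MacPherson) polynomial whose value at $q=|K|$, for every finite field $K$, is the number of flags $f$ in $K^r$ such that $(f_1,f)$ has matrix $A$ and $(f,f_2)$ has matrix $A'$, where $(f_1,f_2)$ is any pair of flags in $K^r$ with matrix $A''$. The $q$-Schur algebra $S_q(n,r)$ is the free $\mathbb Z[q]$-module on the elements $e_A$ with the $\mathbb Z[q]$-bilinear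 product $e_Ae_{A'}=\sum_{A''}g_{A,A',A''}e_{A''}$. Write $[f,f']=e_{A(f,f')}$. Then the element $[f_1,f_1+f_2]\,[f_1+f_2,f_2]$ depends only on the $\mathrm{GL}(V)$-orbit of $(f_1,f_2)$, and the family of these elements, indexed by the orbits of $\mathrm{GL}(V)$ on $\mathcal F\times\mathcal F$, is a $\mathbb Z[q]$-basis of $S_q(n,r)$. Moreover, this basis is unitriangular with respect to the size of $f_1+f_2$: for all $f_1,f_2\in\mathcal F$, the difference $[f_1,f_1+f_2]\,[f_1+f_2,f_2]-[f_1,f_2]$ is a $\mathbb Z[q]$-linear combination of elements $[g_1,g_2]$ with $\dim (g_1+g_2)_i\le\dim(f_1+f_2)_i$ for all $i$ and with strict inequality for at least one $i$. -/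

import Mathlib

open Polynomial

/-- An `n`-step flag `0 = V₀ ⊆ V₁ ⊆ ⋯ ⊆ Vₙ = V` (repetitions are allowed) in the vector space `V`. -/
@[ext]
structure StepFlag (k V : Type*) [Field k] [AddCommGroup V] [Module k V] (n : ℕ) where
  /-- The subspaces `V₀, …, Vₙ`. -/
  space : Fin (n + 1) → Submodule k V
  mono : Monotone space
  space_zero : space 0 = ⊥
  space_last : space (Fin.last n) = ⊤

namespace StepFlag

variable {k V : Type*} [Field k] [AddCommGroup V] [Module k V] {n : ℕ}

/-- The sum `f₁ + f₂` of two flags, formed at each step; it is written `f₁ ⊔ f₂`. -/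
instance : Max (StepFlag k V n) where
  max f g :=
    { space := fun i => f.space i ⊔ g.space i
      mono := fun _ _ h => sup_le_sup (f.mono h) (g.mono h)
      space_zero := by simp [f.space_zero, g.space_zero]
      space_last := by simp [f.space_last, g.space_last] }

/-- The group `GL(V)` of linear automorphisms of `V` acts on flags by change of basis. The action on
pairs of flags is then Mathlib's diagonal action on a product. -/
instance : MulAction (V ≃ₗ[k] V) (StepFlag k V n) where
  smul g f :=
    { space := fun i => (f.space i).map (g : V →ₗ[k] V)
      mono := fun _ _ h => Submodule.map_mono (f.mono h)
      space_zero := by simp [f.space_zero]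
      space_last := by simp [f.space_last] }
  one_smul f := by
    ext i x
    change x ∈ (f.space i).map ((1 : V ≃ₗ[k] V) : V →ₗ[k] V) ↔ _
    simp
  mul_smul g h f := by
    ext i x
    change x ∈ (f.space i).map ((g * h : V ≃ₗ[k] V) : V →ₗ[k] V) ↔
      x ∈ ((f.space i).map (h : V →ₗ[k] V)).map (g : V →ₗ[k] V)
    simp only [Submodule.mem_map]
    constructor
    · rintro ⟨y, hy, rfl⟩
      exact ⟨h y, ⟨y, hy, rfl⟩, rfl⟩
    · rintro ⟨_, ⟨y, hy, rfl⟩, rfl⟩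
      exact ⟨y, hy, rfl⟩

/-- The set `(ℱ × ℱ) / GL(V)` of orbits of pairs of flags under the diagonal action. -/
abbrev PairOrbit (k V : Type*) [Field k] [AddCommGroup V] [Module k V] (n : ℕ) :=
  MulAction.orbitRel.Quotient (V ≃ₗ[k] V) (StepFlag k V n × StepFlag k V n)

/-- The orbit of the pair `(f, f')`. -/
def pairOrbit (f f' : StepFlag k V n) : PairOrbit k V n :=
  Quotient.mk _ (f, f')

/-- The size of a flag: the dimension vector `(dim Vᵢ)ᵢ`, ordered componentwise. -/
noncomputable def dimVec (f : StepFlag k V n) : Fin (n + 1) → ℕ :=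
  fun i => Module.finrank k (f.space i)

/-- The matrix `A(f, f')` of a pair of flags,
`A i j = dim (Vᵢ₋₁ + Vᵢ ∩ V'ⱼ) - dim (Vᵢ₋₁ + Vᵢ ∩ V'ⱼ₋₁)` for `1 ≤ i, j ≤ n`. -/
noncomputable def relMatrix (f f' : StepFlag k V n) : Matrix (Fin n) (Fin n) ℕ :=
  fun i j =>
    Module.finrank k ↥(f.space i.castSucc ⊔ f.space i.succ ⊓ f'.space j.succ) -
      Module.finrank k ↥(f.space i.castSucc ⊔ f.space i.succ ⊓ f'.space j.castSucc)

theorem sum_fin_tsub (n : ℕ) (F : Fin (n + 1) → ℕ) (hF : Monotone F) :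
    ∑ i : Fin n, (F i.succ - F i.castSucc) = F (Fin.last n) - F 0 := by
  induction n with
  | zero => simp
  | succ n ih =>
    rw [Fin.sum_univ_castSucc]
    have h := ih (fun i => F i.castSucc) (fun a b hab => hF (by simpa using hab))
    simp only [Fin.succ_castSucc] at h ⊢
    rw [h]
    have h1 : F 0 ≤ F (Fin.last n).castSucc := hF (Fin.zero_le _)
    have h2 : F (Fin.last n).castSucc ≤ F (Fin.last (n + 1)) := hF (Fin.le_last _)
    have h3 : F (Fin.castSucc 0) = F 0 := rfl
    have h4 : F (Fin.last n).succ = F (Fin.last (n + 1)) := rfl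
    omega

theorem sum_relMatrix [Module.Finite k V] (f f' : StepFlag k V n) :
    ∑ i, ∑ j, relMatrix f f' i j = Module.finrank k V := by
  have row : ∀ i : Fin n, ∑ j, relMatrix f f' i j =
      Module.finrank k (f.space i.succ) - Module.finrank k (f.space i.castSucc) := by
    intro i
    have h := sum_fin_tsub n
      (fun j => Module.finrank k ↥(f.space i.castSucc ⊔ f.space i.succ ⊓ f'.space j))
      (fun a b hab => Submodule.finrank_mono
        (sup_le_sup le_rfl (inf_le_inf le_rfl (f'.mono hab))))
    have hle : f.space i.castSucc ≤ f.space i.succ := f.mono (Fin.castSucc_lt_succ).le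
    refine h.trans ?_
    rw [f'.space_zero, f'.space_last, inf_top_eq, inf_bot_eq, sup_bot_eq, sup_eq_right.mpr hle]
  refine (Finset.sum_congr rfl fun i _ => row i).trans ?_
  refine (sum_fin_tsub n (fun i => Module.finrank k (f.space i))
    (fun a b hab => Submodule.finrank_mono (f.mono hab))).trans ?_
  rw [f.space_last, f.space_zero, finrank_top, finrank_bot, Nat.sub_zero]

end StepFlag

/-- The `n × n` matrices of natural numbers with entries summing to `r`. Over every field they label
the orbits of pairs of `n`-step flags in an `r`-dimensional space: the orbit `e_A` consists of the
pairs of flags with matrix `A`. -/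
def OrbitLabel (n r : ℕ) : Type :=
  {A : Matrix (Fin n) (Fin n) ℕ // ∑ i, ∑ j, A i j = r}

theorem OrbitLabel.entry_le {n r : ℕ} (A : OrbitLabel n r) (i j : Fin n) : A.1 i j ≤ r := by
  have h1 : A.1 i j ≤ ∑ j', A.1 i j' :=
    Finset.single_le_sum (f := fun j' => A.1 i j') (fun _ _ => Nat.zero_le _) (Finset.mem_univ j)
  have h2 : ∑ j', A.1 i j' ≤ ∑ i', ∑ j', A.1 i' j' :=
    Finset.single_le_sum (f := fun i' => ∑ j', A.1 i' j') (fun _ _ => Nat.zero_le _)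
      (Finset.mem_univ i)
  exact (h1.trans h2).trans A.2.le

instance (n r : ℕ) : Finite (OrbitLabel n r) :=
  Finite.of_injective
    (fun (A : OrbitLabel n r) (i j : Fin n) =>
      (⟨A.1 i j, Nat.lt_succ_of_le (A.entry_le i j)⟩ : Fin (r + 1)))
    (fun A B h => Subtype.ext (by
      funext i j
      exact congrArg Fin.val (congrFun (congrFun h i) j)))

noncomputable instance (n r : ℕ) : Fintype (OrbitLabel n r) := Fintype.ofFinite _

noncomputable instance (n r : ℕ) : DecidableEq (OrbitLabel n r) := Classical.decEq _

/-- The label of the orbit of a pair of flags in an `r`-dimensional space. -/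
noncomputable def StepFlag.label {k V : Type*} [Field k] [AddCommGroup V] [Module k V]
    [Module.Finite k V] {n r : ℕ} (hV : Module.finrank k V = r) (f f' : StepFlag k V n) :
    OrbitLabel n r :=
  ⟨StepFlag.relMatrix f f', (StepFlag.sum_relMatrix f f').trans hV⟩

/-- `p` is the structure polynomial `g_{A, A', A''}`: for every finite field `k` with `q` elements
and every pair `(f₁, f₂)` in the orbit `e_{A''}`, the value `p(q)` is the number of flags `f`
with `(f₁, f) ∈ e_A` and `(f, f₂) ∈ e_{A'}`. (Every finite field is isomorphic to one in `Type`.) -/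
def IsStructurePolynomial {n r : ℕ} (A A' A'' : OrbitLabel n r) (p : ℤ[X]) : Prop :=
  ∀ (k : Type) [Field k] [Finite k] (f₁ f₂ : StepFlag k (Fin r → k) n),
    f₁.relMatrix f₂ = A''.1 →
      p.eval (Nat.card k : ℤ) =
        (Nat.card {f : StepFlag k (Fin r → k) n // f₁.relMatrix f = A.1 ∧ f.relMatrix f₂ = A'.1} : ℤ)

open Classical in
/-- The structure polynomial `g_{A, A', A''} ∈ ℤ[q]`. By a theorem of Beilinson, Lusztig and
MacPherson it exists for all `A, A', A''`, so that the second branch never occurs; it is unique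
because each orbit `e_{A''}` is nonempty over each of the infinitely many finite fields. -/
noncomputable def structurePolynomial {n r : ℕ} (A A' A'' : OrbitLabel n r) : ℤ[X] :=
  if h : ∃ p : ℤ[X], IsStructurePolynomial A A' A'' p then h.choose else 0

/-- The `q`-Schur algebra `S_q(n, r)` as a `ℤ[q]`-module: free on the orbits `e_A`. -/
def QSchur (n r : ℕ) : Type := OrbitLabel n r → ℤ[X]

namespace QSchur

variable {n r : ℕ}

noncomputable instance : AddCommGroup (QSchur n r) :=
  inferInstanceAs (AddCommGroup (OrbitLabel n r → ℤ[X]))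

noncomputable instance : Module ℤ[X] (QSchur n r) :=
  inferInstanceAs (Module ℤ[X] (OrbitLabel n r → ℤ[X]))

/-- The basis element `e_A`. -/
noncomputable def e (A : OrbitLabel n r) : QSchur n r :=
  (Pi.single A 1 : OrbitLabel n r → ℤ[X])

/-- The `ℤ[q]`-bilinear multiplication with `e_A e_{A'} = ∑_{A''} g_{A, A', A''} e_{A''}`. -/
noncomputable instance : Mul (QSchur n r) where
  mul x y := fun A'' => ∑ A, ∑ A', x A * y A' * structurePolynomial A A' A''

theorem mul_apply (x y : QSchur n r) (A'' : OrbitLabel n r) :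
    (x * y) A'' = ∑ A, ∑ A', x A * y A' * structurePolynomial A A' A'' := rfl

theorem e_mul_e (A A' : OrbitLabel n r) :
    e A * e A' = ∑ A'', structurePolynomial A A' A'' • e A'' := by
  funext B
  have hR : (∑ A'', structurePolynomial A A' A'' • e A'' : QSchur n r) B =
      ∑ A'', structurePolynomial A A' A'' * (Pi.single A'' 1 : OrbitLabel n r → ℤ[X]) B :=
    Finset.sum_apply (M := fun _ : OrbitLabel n r => ℤ[X]) B Finset.univ
      (fun A'' => structurePolynomial A A' A'' • (Pi.single A'' 1 : OrbitLabel n r → ℤ[X]))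
  rw [hR, mul_apply]
  simp [e, Pi.single_apply, Finset.sum_ite_eq]

/-- The basis element `[f, f']` of `S_q(n, r)` given by the orbit of a pair of flags in an
`r`-dimensional vector space. -/
noncomputable def orb {k V : Type*} [Field k] [AddCommGroup V] [Module k V] [Module.Finite k V]
    (hV : Module.finrank k V = r) (f f' : StepFlag k V n) : QSchur n r :=
  e (StepFlag.label hV f f')

end QSchur

/-! The orbit of a pair of flags is encoded by the dimensions of the intersections `Vᵢ ∩ V'ⱼ`
(`relMatrix_eq_iff`, `pairOrbit_eq_iff`). These numbers make sense over every field, so a pair over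
`k` can be compared with pairs over finite fields, where the structure polynomials count flags.

Suppose `g` lies relative to `g₁` and `g₂` as `f₁ + f₂` does to `f₁` and `f₂`. Containment is
visible in intersection dimensions, so `g` contains `g₁ + g₂` (`sup_le_of_infDim_eq`). Hence any
`[g₁, g₂]` occurring in the product has `dim (g₁ + g₂) ≤ dim (f₁ + f₂)`. If equality holds, then `g
= g₁ + g₂`, and by the modular law the positions of `g₁` and `g₂` relative to their sum determine
the orbit of `(g₁, g₂)` (`infDim_sup_iff`), which is that of `(f₁, f₂)`. For that orbit `g` is
unique, so the coefficient is 1. This is the unitriangularity. By well-founded induction the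
products span, and a spanning family whose size is the rank is a basis.

All this requires the structure polynomials to exist, since the definition of `structurePolynomial`
falls back to 0. An intermediate flag is a chain of subspaces, chosen from the top down. The number
of choices at each stage is polynomial in `q` by induction on dimension, through intersection with a
hyperplane (`exists_isSubspaceCount`, `exists_chain_count`). -/

theorem Fin.exists_castSucc_succ_of_not {n : ℕ} {p : Fin (n + 1) → Prop} (h0 : ¬ p 0)
    (hl : p (Fin.last n)) : ∃ i : Fin n, ¬ p i.castSucc ∧ p i.succ := by
  by_contra! h
  exact Fin.induction (motive := fun i => ¬ p i) h0 (fun i hi => h i hi) (Fin.last n) hl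

/-! ### Relative position of two flags, adapted bases and orbits -/

namespace StepFlag

variable {k V : Type*} [Field k] [AddCommGroup V] [Module k V] {n : ℕ}

/-- The dimension of the intersection `Vᵢ ∩ V'ⱼ`. -/
noncomputable def infDim (f f' : StepFlag k V n) (i j : Fin (n + 1)) : ℕ :=
  Module.finrank k ↥(f.space i ⊓ f'.space j)

theorem infDim_comm (f f' : StepFlag k V n) (i j : Fin (n + 1)) :
    infDim f f' i j = infDim f' f j i := by
  rw [infDim, infDim, inf_comm]

theorem infDim_zero_left (f f' : StepFlag k V n) (j : Fin (n + 1)) : infDim f f' 0 j = 0 := by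
  rw [infDim, f.space_zero, bot_inf_eq, finrank_bot]

theorem infDim_zero_right (f f' : StepFlag k V n) (i : Fin (n + 1)) : infDim f f' i 0 = 0 := by
  rw [infDim, f'.space_zero, inf_bot_eq, finrank_bot]

theorem infDim_last_right (f f' : StepFlag k V n) (i : Fin (n + 1)) :
    infDim f f' i (Fin.last n) = f.dimVec i := by
  rw [infDim, f'.space_last, inf_top_eq, dimVec]

theorem infDim_last_left (f f' : StepFlag k V n) (j : Fin (n + 1)) :
    infDim f f' (Fin.last n) j = f'.dimVec j := by
  rw [infDim, f.space_last, top_inf_eq, dimVec]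

theorem castSucc_le_succ (f : StepFlag k V n) (i : Fin n) :
    f.space i.castSucc ≤ f.space i.succ :=
  f.mono Fin.castSucc_lt_succ.le

theorem smul_space (g : V ≃ₗ[k] V) (f : StepFlag k V n) (i : Fin (n + 1)) :
    (g • f).space i = (f.space i).map (g : V →ₗ[k] V) := rfl

theorem infDim_smul (g : V ≃ₗ[k] V) (f f' : StepFlag k V n) (i j : Fin (n + 1)) :
    infDim (g • f) (g • f') i j = infDim f f' i j := by
  rw [infDim, smul_space, smul_space, ← Submodule.map_inf _ g.injective]
  exact LinearEquiv.finrank_map_eq g _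

variable [Module.Finite k V]

theorem finrank_sup_add_infDim (f f' : StepFlag k V n) (i : Fin n) (j : Fin (n + 1)) :
    Module.finrank k ↥(f.space i.castSucc ⊔ f.space i.succ ⊓ f'.space j) +
      infDim f f' i.castSucc j = f.dimVec i.castSucc + infDim f f' i.succ j := by
  have h := Submodule.finrank_sup_add_finrank_inf_eq (f.space i.castSucc)
    (f.space i.succ ⊓ f'.space j)
  rwa [← inf_assoc, inf_eq_left.mpr (f.castSucc_le_succ i)] at h

/-- By inclusion–exclusion the matrix entry is the mixed second difference of `infDim`. Sums on both
sides avoid truncated subtraction. -/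
theorem relMatrix_add (f f' : StepFlag k V n) (i j : Fin n) :
    relMatrix f f' i j + infDim f f' i.castSucc j.succ + infDim f f' i.succ j.castSucc =
      infDim f f' i.succ j.succ + infDim f f' i.castSucc j.castSucc := by
  have h1 := finrank_sup_add_infDim f f' i j.succ
  have h2 := finrank_sup_add_infDim f f' i j.castSucc
  have h3 : Module.finrank k ↥(f.space i.castSucc ⊔ f.space i.succ ⊓ f'.space j.castSucc) ≤
      Module.finrank k ↥(f.space i.castSucc ⊔ f.space i.succ ⊓ f'.space j.succ) :=
    Submodule.finrank_mono (sup_le_sup le_rfl (inf_le_inf le_rfl (f'.castSucc_le_succ j)))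
  simp only [relMatrix]
  omega

/-- The matrix of a pair of flags and the dimensions of the intersections `Vᵢ ∩ V'ⱼ` determine each
other, even across different fields. -/
theorem relMatrix_eq_iff {K W : Type*} [Field K] [AddCommGroup W] [Module K W] [Module.Finite K W]
    (f f' : StepFlag k V n) (g g' : StepFlag K W n) :
    relMatrix f f' = relMatrix g g' ↔ ∀ i j, infDim f f' i j = infDim g g' i j := by
  constructor
  · intro h i
    induction i using Fin.induction with
    | zero => intro j; rw [infDim_zero_left, infDim_zero_left]
    | succ i ih =>
      intro j
      induction j using Fin.induction with
      | zero => rw [infDim_zero_right, infDim_zero_right]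
      | succ j ihj =>
        have h1 := relMatrix_add f f' i j
        have h2 := relMatrix_add g g' i j
        rw [h, ih, ih, ihj] at h1
        omega
  · intro h
    ext i j
    have h1 := relMatrix_add f f' i j
    have h2 := relMatrix_add g g' i j
    simp only [h] at h1
    omega

theorem label_eq_iff {r : ℕ} (hV : Module.finrank k V = r) {K W : Type*} [Field K] [AddCommGroup W]
    [Module K W] [Module.Finite K W] (hW : Module.finrank K W = r)
    (f f' : StepFlag k V n) (g g' : StepFlag K W n) :
    label hV f f' = label hW g g' ↔ ∀ i j, infDim f f' i j = infDim g g' i j := by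
  rw [← relMatrix_eq_iff]
  exact Subtype.ext_iff

/-- The index set of a basis adapted to a pair of flags with matrix `A`. -/
abbrev AdaptedIndex (A : Matrix (Fin n) (Fin n) ℕ) : Type :=
  Σ p : Fin n × Fin n, Fin (A p.1 p.2)

theorem card_adaptedIndex {r : ℕ} (A : OrbitLabel n r) : Fintype.card (AdaptedIndex A.1) = r := by
  rw [Fintype.card_sigma, Fintype.sum_prod_type]
  simpa using A.2

/-- Vectors that complete the lower part of `Vᵢ ∩ V'ⱼ` to all of it. -/
theorem exists_sup_span_eq (f f' : StepFlag k V n) (i j : Fin n) :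
    ∃ v : Fin (relMatrix f f' i j) → V,
      (f.space i.castSucc ⊓ f'.space j.succ) ⊔ (f.space i.succ ⊓ f'.space j.castSucc) ⊔
        Submodule.span k (Set.range v) = f.space i.succ ⊓ f'.space j.succ := by
  set B := (f.space i.castSucc ⊓ f'.space j.succ) ⊔ (f.space i.succ ⊓ f'.space j.castSucc)
  set M := f.space i.succ ⊓ f'.space j.succ
  have hB : B ≤ M := sup_le (inf_le_inf (f.castSucc_le_succ i) le_rfl)
    (inf_le_inf le_rfl (f'.castSucc_le_succ j))
  obtain ⟨C, hC⟩ := Submodule.exists_isCompl B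
  have hsup : B ⊔ C ⊓ M = M := by
    rw [← sup_inf_assoc_of_le _ hB, hC.sup_eq_top, top_inf_eq]
  have hinf : B ⊓ (C ⊓ M) = ⊥ := by
    rw [← inf_assoc, hC.inf_eq_bot, bot_inf_eq]
  -- The two summands of `B` meet in `Vᵢ₋₁ ∩ V'ⱼ₋₁`, so the codimension of `B` in `M` is the mixed
  -- second difference of `infDim`.
  have hdim : Module.finrank k ↥(C ⊓ M) = relMatrix f f' i j := by
    have h1 := Submodule.finrank_sup_add_finrank_inf_eq B (C ⊓ M)
    have h2 := Submodule.finrank_sup_add_finrank_inf_eq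
      (f.space i.castSucc ⊓ f'.space j.succ) (f.space i.succ ⊓ f'.space j.castSucc)
    have h3 : (f.space i.castSucc ⊓ f'.space j.succ) ⊓ (f.space i.succ ⊓ f'.space j.castSucc) =
        f.space i.castSucc ⊓ f'.space j.castSucc := by
      rw [inf_inf_inf_comm, inf_eq_left.mpr (f.castSucc_le_succ i),
        inf_eq_right.mpr (f'.castSucc_le_succ j)]
    rw [hsup, hinf, finrank_bot] at h1
    rw [h3] at h2
    have h4 := relMatrix_add f f' i j
    simp only [infDim] at h4
    change Module.finrank k ↥B + _ = _ at h2
    change _ = Module.finrank k ↥M + _ at h4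
    omega
  let b := Module.finBasisOfFinrankEq k ↥(C ⊓ M) hdim
  refine ⟨fun m => (b m : V), ?_⟩
  have : Submodule.span k (Set.range fun m => (b m : V)) = C ⊓ M := by
    have h := congrArg (Submodule.map (C ⊓ M).subtype) b.span_eq
    rw [Submodule.map_span, ← Set.range_comp, Submodule.map_top, Submodule.range_subtype] at h
    exact h
  rw [this, hsup]

/-- Every pair of flags is a pair of coordinate flags with respect to a suitable basis. -/
theorem exists_adapted (f f' : StepFlag k V n) :
    ∃ φ : V ≃ₗ[k] (AdaptedIndex (relMatrix f f') →₀ k),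
      (∀ i, f.space i = (Finsupp.supported k k
        {s : AdaptedIndex (relMatrix f f') | s.1.1.castSucc < i}).comap (φ : V →ₗ[k] _)) ∧
      ∀ j, f'.space j =
        (Finsupp.supported k k
        {s : AdaptedIndex (relMatrix f f') | s.1.2.castSucc < j}).comap (φ : V →ₗ[k] _) := by
  choose v hv using exists_sup_span_eq f f'
  let w : AdaptedIndex (relMatrix f f') → V := fun s => v s.1.1 s.1.2 s.2
  have hw : ∀ s, w s ∈ f.space s.1.1.succ ⊓ f'.space s.1.2.succ := by
    intro s
    rw [← hv]
    exact Submodule.mem_sup_right (Submodule.subset_span ⟨s.2, rfl⟩)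
  -- Double induction over the grid: each intersection is spanned by its two smaller neighbours and
  -- the new vectors of its cell.
  have hle : ∀ i j, f.space i ⊓ f'.space j ≤
      Submodule.span k (w '' {s | s.1.1.castSucc < i ∧ s.1.2.castSucc < j}) := by
    intro i
    induction i using Fin.induction with
    | zero => intro j; rw [f.space_zero, bot_inf_eq]; exact bot_le
    | succ i ih =>
      intro j
      induction j using Fin.induction with
      | zero => rw [f'.space_zero, inf_bot_eq]; exact bot_le
      | succ j ihj =>
        rw [← hv]
        refine sup_le (sup_le ((ih _).trans ?_) (ihj.trans ?_)) ?_
        · refine Submodule.span_mono (Set.image_mono fun s hs => ⟨?_, hs.2⟩)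
          exact hs.1.trans Fin.castSucc_lt_succ
        · refine Submodule.span_mono (Set.image_mono fun s hs => ⟨hs.1, ?_⟩)
          exact hs.2.trans Fin.castSucc_lt_succ
        · refine Submodule.span_mono ?_
          rintro _ ⟨m, rfl⟩
          exact ⟨⟨(i, j), m⟩, ⟨Fin.castSucc_lt_succ, Fin.castSucc_lt_succ⟩, rfl⟩
  have htop : ⊤ ≤ Submodule.span k (Set.range w) := by
    have h := hle (Fin.last n) (Fin.last n)
    rw [f.space_last, f'.space_last, inf_top_eq] at h
    exact h.trans (Submodule.span_mono (Set.image_subset_range _ _))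
  -- The matrix entries sum to `dim V`, so the spanning family `w` is a basis.
  have hcard := card_adaptedIndex (label rfl f f')
  let b := basisOfTopLeSpanOfCardEqFinrank w htop hcard
  have hb : ⇑b = w := coe_basisOfTopLeSpanOfCardEqFinrank _ _ _
  have key : ∀ T : Set (AdaptedIndex (relMatrix f f')),
      (Finsupp.supported k k T).comap (b.repr : V →ₗ[k] _) = Submodule.span k (w '' T) := by
    intro T
    ext x
    rw [← hb, b.mem_span_image]
    rfl
  refine ⟨b.repr, fun i => ?_, fun j => ?_⟩
  · rw [key]
    apply le_antisymm
    · have h := hle i (Fin.last n)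
      rw [f'.space_last, inf_top_eq] at h
      exact h.trans (Submodule.span_mono (Set.image_mono fun s hs => hs.1))
    · rw [Submodule.span_le]
      rintro _ ⟨s, hs, rfl⟩
      exact f.mono (Fin.castSucc_lt_iff_succ_le.mp hs) (hw s).1
  · rw [key]
    apply le_antisymm
    · have h := hle (Fin.last n) j
      rw [f.space_last, top_inf_eq] at h
      exact h.trans (Submodule.span_mono (Set.image_mono fun s hs => hs.2))
    · rw [Submodule.span_le]
      rintro _ ⟨s, hs, rfl⟩
      exact f'.mono (Fin.castSucc_lt_iff_succ_le.mp hs) (hw s).2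

/-- Pairs with equal matrices have adapted bases with the same index set. The automorphism matching
these bases carries coordinate subspaces to coordinate subspaces, hence one pair to the other. -/
theorem pairOrbit_eq_iff (f f' g g' : StepFlag k V n) :
    pairOrbit f f' = pairOrbit g g' ↔ relMatrix f f' = relMatrix g g' := by
  have hrel : pairOrbit f f' = pairOrbit g g' ↔ ∃ a : V ≃ₗ[k] V, a • g = f ∧ a • g' = f' := by
    rw [pairOrbit, pairOrbit, Quotient.eq, MulAction.orbitRel_apply, MulAction.mem_orbit_iff]
    simp [Prod.ext_iff]
  rw [hrel]
  constructor
  · rintro ⟨a, rfl, rfl⟩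
    exact (relMatrix_eq_iff _ _ _ _).mpr fun i j => infDim_smul a g g' i j
  · intro h
    obtain ⟨φ, h1, h2⟩ := exists_adapted f f'
    have hg := exists_adapted g g'
    rw [← h] at hg
    obtain ⟨ψ, h3, h4⟩ := hg
    have key : ∀ N : Submodule k (AdaptedIndex (relMatrix f f') →₀ k),
        (N.comap (ψ : V →ₗ[k] _)).map ((ψ.trans φ.symm : V ≃ₗ[k] V) : V →ₗ[k] V) =
          N.comap (φ : V →ₗ[k] _) := by
      intro N
      ext x
      simp only [Submodule.mem_map, Submodule.mem_comap]
      constructor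
      · rintro ⟨y, hy, rfl⟩
        simpa using hy
      · intro hx
        exact ⟨ψ.symm (φ x), by simpa using hx, by simp⟩
    refine ⟨ψ.trans φ.symm, ?_, ?_⟩
    · ext1; funext i
      rw [smul_space, h1, h3, key]
    · ext1; funext i
      rw [smul_space, h2, h4, key]

/-- Over every field, every matrix of size `r` is the matrix of a pair of flags. -/
theorem exists_relMatrix_eq {r : ℕ} (hV : Module.finrank k V = r) (A : OrbitLabel n r) :
    ∃ f f' : StepFlag k V n, relMatrix f f' = A.1 := by
  classical
  let φ : V ≃ₗ[k] (AdaptedIndex A.1 →₀ k) := LinearEquiv.ofFinrankEq _ _ (by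
    rw [hV, Module.finrank_finsupp_self, card_adaptedIndex])
  let S : Set (AdaptedIndex A.1) → Submodule k V := fun T =>
    (Finsupp.supported k k T).comap (φ : V →ₗ[k] _)
  have Smono : Monotone S := fun T T' h => Submodule.comap_mono (Finsupp.supported_mono h)
  have Sempty : S ∅ = ⊥ := by
    simp only [S, Finsupp.supported_empty]
    exact LinearEquiv.ker φ
  have Suniv : S Set.univ = ⊤ := by
    simp only [S, Finsupp.supported_univ, Submodule.comap_top]
  have Sinf : ∀ T T', S T ⊓ S T' = S (T ∩ T') := by
    intro T T'
    simp only [S, Finsupp.supported_inter, Submodule.comap_inf]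
  have Sdim : ∀ T, Module.finrank k ↥(S T) = (Finset.univ.filter (· ∈ T)).card := by
    intro T
    have h1 : Module.finrank k ↥(S T) = Module.finrank k ↥(Finsupp.supported k k T) :=
      (LinearEquiv.ofSubmodule' φ _).finrank_eq
    rw [h1, (Finsupp.supportedEquivFinsupp T).finrank_eq, Module.finrank_finsupp_self,
      Fintype.card_subtype]
  let f : StepFlag k V n :=
    { space := fun i => S {s | s.1.1.castSucc < i}
      mono := fun i j h => Smono fun s hs => lt_of_lt_of_le hs h
      space_zero := by
        rw [← Sempty]; congr 1; ext s; simp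
      space_last := by
        rw [← Suniv]; congr 1; ext s; simp [Fin.castSucc_lt_last] }
  let f' : StepFlag k V n :=
    { space := fun i => S {s | s.1.2.castSucc < i}
      mono := fun i j h => Smono fun s hs => lt_of_lt_of_le hs h
      space_zero := by
        rw [← Sempty]; congr 1; ext s; simp
      space_last := by
        rw [← Suniv]; congr 1; ext s; simp [Fin.castSucc_lt_last] }
  -- Coordinate subspaces intersect in coordinate subspaces, so the dimension counts basis vectors
  -- in the cells below `(i, j)`. The second difference of this count is the entry of `A`.
  have hd : ∀ i j, infDim f f' i j = ∑ p : Fin n × Fin n,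
      A.1 p.1 p.2 * ((if p.1.castSucc < i then 1 else 0) * (if p.2.castSucc < j then 1 else 0)) := by
    intro i j
    have : infDim f f' i j = Module.finrank k
      ↥(S ({s | s.1.1.castSucc < i} ∩ {s | s.1.2.castSucc < j})) := by rw [← Sinf]; rfl
    rw [this, Sdim, Finset.card_filter, Fintype.sum_sigma]
    refine Finset.sum_congr rfl fun p _ => ?_
    by_cases h1 : p.1.castSucc < i <;> by_cases h2 : p.2.castSucc < j <;> simp [h1, h2]
  refine ⟨f, f', ?_⟩
  ext i j
  have h := relMatrix_add f f' i j
  simp only [hd] at h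
  have ind : ∀ a b : Fin n, (if a.castSucc < b.succ then 1 else 0) =
      (if a.castSucc < b.castSucc then 1 else 0) + if a = b then 1 else 0 := by
    intro a b
    rcases lt_trichotomy a b with hab | hab | hab
    · simp [hab, hab.ne, Fin.castSucc_lt_succ_iff, hab.le]
    · simp [hab]
    · simp [hab.ne', Fin.castSucc_lt_succ_iff, hab.not_ge, hab.not_gt]
  have hA : A.1 i j = ∑ p : Fin n × Fin n,
      A.1 p.1 p.2 * ((if p.1 = i then 1 else 0) * (if p.2 = j then 1 else 0)) := by
    rw [Fintype.sum_prod_type]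
    simp
  have h' : A.1 i j + infDim f f' i.castSucc j.succ + infDim f f' i.succ j.castSucc =
      infDim f f' i.succ j.succ + infDim f f' i.castSucc j.castSucc := by
    rw [hA, hd, hd, hd, hd, ← Finset.sum_add_distrib, ← Finset.sum_add_distrib,
      ← Finset.sum_add_distrib]
    refine Finset.sum_congr rfl fun p _ => ?_
    rw [ind, ind]
    ring
  simp only [hd] at h'
  omega

end StepFlag

theorem Nat.card_subtype_eq_card_filter {α : Type*} [Fintype α] (p : α → Prop) [DecidablePred p] :
    Nat.card {x // p x} = (Finset.univ.filter p).card := by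
  rw [Nat.card_eq_fintype_card, Fintype.card_subtype]

/-! ### Counting extensions of a subspace of a hyperplane -/

section Hyperplane

variable {k V : Type*} [Field k] [AddCommGroup V] [Module k V]

/-- The slice `φ = 1` of a subspace not contained in `ker φ` is a translate of its intersection with
`ker φ`. -/
theorem Submodule.card_slice (φ : V →ₗ[k] k) {Y : Submodule k V} (hY : ¬ Y ≤ LinearMap.ker φ) :
    Nat.card {x : V // x ∈ Y ∧ φ x = 1} = Nat.card ↥(Y ⊓ LinearMap.ker φ) := by
  obtain ⟨y, hy, hφ⟩ := SetLike.not_le_iff_exists.mp hY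
  rw [LinearMap.mem_ker] at hφ
  have hx : φ ((φ y)⁻¹ • y) = 1 := by simp [hφ]
  have hxY : (φ y)⁻¹ • y ∈ Y := Y.smul_mem _ hy
  set x := (φ y)⁻¹ • y
  refine Nat.card_congr
    { toFun := fun z => ⟨z.1 - x, Y.sub_mem z.2.1 hxY, ?_⟩
      invFun := fun z => ⟨z.1 + x, Y.add_mem z.2.1 hxY, ?_⟩
      left_inv := fun z => by simp
      right_inv := fun z => by simp }
  · rw [SetLike.mem_coe, LinearMap.mem_ker, map_sub, z.2.2, hx, sub_self]
  · rw [map_add, hx, LinearMap.mem_ker.mp z.2.2, zero_add]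

variable [Module.Finite k V]

theorem Submodule.finrank_inf_ker_add_one (φ : V →ₗ[k] k) {Y : Submodule k V}
    (hY : ¬ Y ≤ LinearMap.ker φ) :
    Module.finrank k ↥(Y ⊓ LinearMap.ker φ) + 1 = Module.finrank k Y := by
  have h0 : φ.domRestrict Y ≠ 0 := by
    intro h
    exact hY fun y hy => LinearMap.congr_fun h ⟨y, hy⟩
  have h1 := Module.Dual.finrank_ker_add_one_of_ne_zero (f := φ.domRestrict Y) h0
  have h2 : Y ⊓ LinearMap.ker φ = (LinearMap.ker (φ.domRestrict Y)).map Y.subtype := by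
    ext x
    simp [and_comm]
  rw [← h1, h2, (Submodule.equivSubtypeMap Y (LinearMap.ker (φ.domRestrict Y))).finrank_eq]

/-- Let `K = ker φ` be a hyperplane. The number of extensions `U ≤ W` of `U' = U ⊓ K` that meet
`X ≤ W` outside `K`. -/
theorem Submodule.card_extensions_mul [Finite k] (φ : V →ₗ[k] k) {W X U' : Submodule k V}
    (hU' : U' ≤ W ⊓ LinearMap.ker φ) (hXW : X ≤ W) (hX : ¬ X ≤ LinearMap.ker φ) :
    Nat.card {U : Submodule k V // U ≤ W ∧ U ⊓ LinearMap.ker φ = U' ∧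
        ¬ U ⊓ X ≤ LinearMap.ker φ} * Nat.card k ^ Module.finrank k ↥(U' ⊓ X) =
      Nat.card k ^ Module.finrank k ↥(X ⊓ LinearMap.ker φ) := by
  classical
  have : Finite V := Module.finite_of_finite k
  have : Fintype V := Fintype.ofFinite V
  have : Fintype (Submodule k V) := Fintype.ofFinite _
  rw [← Module.natCard_eq_pow_finrank, ← Module.natCard_eq_pow_finrank, ← card_slice φ hX,
    Nat.card_subtype_eq_card_filter fun x : V => x ∈ X ∧ φ x = 1,
    Nat.card_subtype_eq_card_filter fun U : Submodule k V => U ≤ W ∧ U ⊓ LinearMap.ker φ = U' ∧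
      ¬ U ⊓ X ≤ LinearMap.ker φ]
  -- Double counting: each `x ∈ X` with `φ x = 1` generates an extension `U' + ⟨x⟩`. The fibre over
  -- `U` is the slice `φ = 1` of `U ∩ X`, a translate of `U' ∩ X`.
  have hmaps : Set.MapsTo (fun x : V => U' ⊔ Submodule.span k {x})
      ↑(Finset.univ.filter fun x : V => x ∈ X ∧ φ x = 1)
      ↑(Finset.univ.filter fun U : Submodule k V => U ≤ W ∧ U ⊓ LinearMap.ker φ = U' ∧
        ¬ U ⊓ X ≤ LinearMap.ker φ) := by
    intro x hx
    simp only [Finset.coe_filter, Finset.mem_univ, true_and, Set.mem_ofPred_eq] at hx ⊢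
    have hxU : x ∈ U' ⊔ Submodule.span k {x} :=
      Submodule.mem_sup_right (Submodule.mem_span_singleton_self x)
    refine ⟨sup_le (hU'.trans inf_le_left) ?_, ?_, ?_⟩
    · rw [Submodule.span_singleton_le_iff_mem]
      exact hXW hx.1
    · refine le_antisymm ?_ (le_inf le_sup_left (hU'.trans inf_le_right))
      rintro u ⟨hu, huK⟩
      obtain ⟨a, ha, b, hb, rfl⟩ := Submodule.mem_sup.mp hu
      obtain ⟨c, rfl⟩ := Submodule.mem_span_singleton.mp hb
      have h1 : φ a = 0 := (hU' ha).2
      have h2 : φ (a + c • x) = 0 := huK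
      rw [map_add, map_smul, h1, hx.2, zero_add, smul_eq_mul, mul_one] at h2
      rwa [h2, zero_smul, add_zero]
    · intro h
      have h1 : φ x = 0 := h ⟨hxU, hx.1⟩
      exact one_ne_zero (hx.2.symm.trans h1)
  rw [Finset.card_eq_sum_card_fiberwise hmaps, Finset.sum_const_nat]
  intro U hU
  simp only [Finset.mem_filter, Finset.mem_univ, true_and] at hU
  have hslice := card_slice φ hU.2.2
  rw [inf_right_comm, hU.2.1] at hslice
  rw [← hslice, Nat.card_subtype_eq_card_filter]
  congr 1
  ext x
  simp only [Finset.mem_filter, Finset.mem_univ, true_and, Submodule.mem_inf]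
  constructor
  · rintro ⟨⟨hx, h1⟩, rfl⟩
    exact ⟨⟨Submodule.mem_sup_right (Submodule.mem_span_singleton_self x), hx⟩, h1⟩
  · rintro ⟨⟨hxU, hx⟩, h1⟩
    refine ⟨⟨hx, h1⟩, le_antisymm (sup_le ?_ ?_) ?_⟩
    · rw [← hU.2.1]; exact inf_le_left
    · rwa [Submodule.span_singleton_le_iff_mem]
    · intro u hu
      have hmem : u - φ u • x ∈ U' := by
        rw [← hU.2.1]
        refine ⟨U.sub_mem hu (U.smul_mem _ hxU), ?_⟩
        rw [SetLike.mem_coe, LinearMap.mem_ker, map_sub, map_smul, h1, smul_eq_mul, mul_one,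
          sub_self]
      exact Submodule.mem_sup.mpr ⟨_, hmem, φ u • x, Submodule.smul_mem _ _
        (Submodule.mem_span_singleton_self x), sub_add_cancel _ _⟩

theorem Submodule.card_extensions [Finite k] (φ : V →ₗ[k] k) {W X U' : Submodule k V}
    (hU' : U' ≤ W ⊓ LinearMap.ker φ) (hXW : X ≤ W) (hX : ¬ X ≤ LinearMap.ker φ) :
    Nat.card {U : Submodule k V // U ≤ W ∧ U ⊓ LinearMap.ker φ = U' ∧
        ¬ U ⊓ X ≤ LinearMap.ker φ} =
      Nat.card k ^
        (Module.finrank k ↥(X ⊓ LinearMap.ker φ) - Module.finrank k ↥(U' ⊓ X)) := by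
  have h := card_extensions_mul φ hU' hXW hX
  have hle : Module.finrank k ↥(U' ⊓ X) ≤ Module.finrank k ↥(X ⊓ LinearMap.ker φ) :=
    Submodule.finrank_mono (le_inf inf_le_right (inf_le_left.trans (hU'.trans inf_le_right)))
  rw [← Nat.sub_add_cancel hle, pow_add] at h
  exact Nat.eq_of_mul_eq_mul_right (pow_pos Nat.card_pos _) h

end Hyperplane

/-! ### Polynomial count of subspaces in given position to two flags -/

namespace StepFlag

section Grid

variable {k V : Type*} [Field k] [AddCommGroup V] [Module k V] {n : ℕ}

/-- The dimensions of the intersections of a subspace `W` with the spaces `Fᵢ ∩ Gⱼ`. -/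
noncomputable def gridDim (F G : StepFlag k V n) (W : Submodule k V) (i j : Fin (n + 1)) : ℕ :=
  Module.finrank k ↥(W ⊓ (F.space i ⊓ G.space j))

theorem gridDim_last_right (F G : StepFlag k V n) (W : Submodule k V) (i : Fin (n + 1)) :
    gridDim F G W i (Fin.last n) = Module.finrank k ↥(W ⊓ F.space i) := by
  rw [gridDim, G.space_last, inf_top_eq]

theorem gridDim_last_left (F G : StepFlag k V n) (W : Submodule k V) (j : Fin (n + 1)) :
    gridDim F G W (Fin.last n) j = Module.finrank k ↥(W ⊓ G.space j) := by
  rw [gridDim, F.space_last, top_inf_eq]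

theorem gridDim_last_last (F G : StepFlag k V n) (W : Submodule k V) :
    gridDim F G W (Fin.last n) (Fin.last n) = Module.finrank k W := by
  rw [gridDim_last_left, G.space_last, inf_top_eq]

theorem gridDim_zero_left (F G : StepFlag k V n) (W : Submodule k V) (j : Fin (n + 1)) :
    gridDim F G W 0 j = 0 := by
  rw [gridDim, F.space_zero, bot_inf_eq, inf_bot_eq, finrank_bot]

theorem gridDim_zero_right (F G : StepFlag k V n) (W : Submodule k V) (i : Fin (n + 1)) :
    gridDim F G W i 0 = 0 := by
  rw [gridDim, G.space_zero, inf_bot_eq, inf_bot_eq, finrank_bot]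

variable [Module.Finite k V]

/-- A hyperplane `ker φ` of `W` whose intersections with the grid are determined by dimensions. -/
theorem exists_hyperplane (F G : StepFlag k V n) (W : Submodule k V) (a b : Fin n)
    (h1 : gridDim F G W a.succ (Fin.last n) = gridDim F G W (Fin.last n) (Fin.last n))
    (h2 : gridDim F G W a.castSucc (Fin.last n) + gridDim F G W (Fin.last n) b.succ =
      gridDim F G W (Fin.last n) (Fin.last n) + gridDim F G W a.castSucc b.succ)
    (h3 : gridDim F G W a.castSucc (Fin.last n) + gridDim F G W (Fin.last n) b.castSucc ≠
      gridDim F G W (Fin.last n) (Fin.last n) + gridDim F G W a.castSucc b.castSucc) :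
    ∃ φ : V →ₗ[k] k, W ≤ F.space a.succ ∧ W ⊓ F.space a.castSucc ≤ LinearMap.ker φ ∧
      W ⊓ G.space b.castSucc ≤ LinearMap.ker φ ∧ ¬ W ⊓ G.space b.succ ≤ LinearMap.ker φ := by
  -- Inclusion–exclusion turns `h2` and `h3` into statements about `W ∩ F_a + W ∩ Gⱼ`: it is all of
  -- `W` for `j = b.succ` and proper for `j = b.castSucc`. The functional `φ` kills the proper one
  -- but not `W`.
  have hsum : ∀ j, gridDim F G W a.castSucc (Fin.last n) + gridDim F G W (Fin.last n) j =
      Module.finrank k ↥((W ⊓ F.space a.castSucc) ⊔ (W ⊓ G.space j)) +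
        gridDim F G W a.castSucc j := by
    intro j
    rw [gridDim_last_right, gridDim_last_left, ← Submodule.finrank_sup_add_finrank_inf_eq,
      ← inf_inf_distrib_left, gridDim]
  have hle : ∀ j, (W ⊓ F.space a.castSucc) ⊔ (W ⊓ G.space j) ≤ W :=
    fun j => sup_le inf_le_left inf_le_left
  rw [gridDim_last_last, gridDim_last_right] at h1
  have hWF : W ≤ F.space a.succ := by
    rw [← inf_eq_left]
    exact Submodule.eq_of_le_of_finrank_eq inf_le_left h1
  rw [hsum, gridDim_last_last] at h2 h3
  have hWb : (W ⊓ F.space a.castSucc) ⊔ (W ⊓ G.space b.succ) = W :=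
    Submodule.eq_of_le_of_finrank_eq (hle _) (by omega)
  have hnot : ¬ W ≤ (W ⊓ F.space a.castSucc) ⊔ (W ⊓ G.space b.castSucc) := by
    intro h
    rw [le_antisymm (hle _) h] at h3
    exact h3 rfl
  obtain ⟨x, hxW, hx⟩ := SetLike.not_le_iff_exists.mp hnot
  obtain ⟨φ, hφx, hφ⟩ := Submodule.exists_le_ker_of_notMem hx
  refine ⟨φ, hWF, le_sup_left.trans hφ, le_sup_right.trans hφ, fun h => hφx ?_⟩
  have hWK : W ≤ LinearMap.ker φ := by
    rw [← hWb]
    exact sup_le (le_sup_left.trans hφ) h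
  exact hWK hxW

/-- Beyond the corner `(a, c)` the space `U ∩ Fᵢ ∩ Gⱼ` contains `U ∩ G_{c+1}`, so it leaves the
hyperplane and loses one dimension. Elsewhere it lies in `U ∩ F_a` or `U ∩ G_c`, hence in the
hyperplane. -/
theorem gridDim_inf_ker (F G : StepFlag k V n) (φ : V →ₗ[k] k) {U : Submodule k V} {a c : Fin n}
    (h1 : U ≤ F.space a.succ) (h2 : U ⊓ F.space a.castSucc ≤ LinearMap.ker φ)
    (h3 : U ⊓ G.space c.castSucc ≤ LinearMap.ker φ)
    (h4 : ¬ U ⊓ G.space c.succ ≤ LinearMap.ker φ) (i j : Fin (n + 1)) :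
    gridDim F G (U ⊓ LinearMap.ker φ) i j +
      (if a.castSucc < i ∧ c.castSucc < j then 1 else 0) = gridDim F G U i j := by
  have hcomm : (U ⊓ LinearMap.ker φ) ⊓ (F.space i ⊓ G.space j) =
      (U ⊓ (F.space i ⊓ G.space j)) ⊓ LinearMap.ker φ := inf_right_comm _ _ _
  rw [gridDim, gridDim, hcomm]
  split_ifs with h
  · refine Submodule.finrank_inf_ker_add_one φ fun hle => h4 (le_trans ?_ hle)
    refine le_inf inf_le_left (le_inf (inf_le_left.trans (h1.trans (F.mono ?_)))
      (inf_le_right.trans (G.mono ?_)))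
    · exact Fin.castSucc_lt_iff_succ_le.mp h.1
    · exact Fin.castSucc_lt_iff_succ_le.mp h.2
  · have hle : U ⊓ (F.space i ⊓ G.space j) ≤ LinearMap.ker φ := by
      rw [not_and_or, not_lt, not_lt] at h
      rcases h with h | h
      · exact (inf_le_inf le_rfl (inf_le_left.trans (F.mono h))).trans h2
      · exact (inf_le_inf le_rfl (inf_le_right.trans (G.mono h))).trans h3
    rw [add_zero, inf_eq_left.mpr hle]

end Grid

section Count

variable {n : ℕ}

/-- Over every finite field with `q` elements, `P(q)` is the number of subspaces `U` of `W` with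
grid dimensions `D`, for every `W` with grid dimensions `E`. -/
def IsSubspaceCount (E D : Fin (n + 1) → Fin (n + 1) → ℕ) (P : ℤ[X]) : Prop :=
  ∀ (k V : Type) [Field k] [Finite k] [AddCommGroup V] [Module k V] [Module.Finite k V]
    (F G : StepFlag k V n) (W : Submodule k V), gridDim F G W = E →
      P.eval (Nat.card k : ℤ) = (Nat.card {U : Submodule k V // U ≤ W ∧ gridDim F G U = D} : ℤ)

/-- The increment of grid dimensions from `U ∩ ker φ` to `U`. -/
def cornerDim (a c : Fin n) (i j : Fin (n + 1)) : ℕ :=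
  if a.castSucc < i ∧ c.castSucc < j then 1 else 0

/-- The polynomial counting the extensions of a subspace of a hyperplane that meet `Gⱼ` outside the
hyperplane. -/
noncomputable def extensionPoly (b : Fin n) (E D : Fin (n + 1) → Fin (n + 1) → ℕ)
    (j : Fin (n + 1)) : ℤ[X] :=
  if b.castSucc < j then X ^ (E (Fin.last n) j - D (Fin.last n) j) else 0

section Fibres

variable {k V : Type*} [Field k] [AddCommGroup V] [Module k V] [Fintype (Submodule k V)]
  (F G : StepFlag k V n) (W : Submodule k V) (φ : V →ₗ[k] k)

open Classical in
-- A subspace outside `ker φ` leaves it at exactly one step of `G`: the indicator of `U ∩ Gⱼ ⊄ ker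
-- φ` is monotone in `j`, and its increments telescope.
theorem card_subspaces_eq_add_sum (D : Fin (n + 1) → Fin (n + 1) → ℕ) :
    (Finset.univ.filter fun U : Submodule k V => U ≤ W ∧ gridDim F G U = D).card =
      (Finset.univ.filter fun U : Submodule k V => U ≤ W ⊓ LinearMap.ker φ ∧
        gridDim F G U = D).card +
      ∑ c : Fin n, (Finset.univ.filter fun U : Submodule k V => U ≤ W ∧ gridDim F G U = D ∧
        U ⊓ G.space c.castSucc ≤ LinearMap.ker φ ∧
        ¬ U ⊓ G.space c.succ ≤ LinearMap.ker φ).card := by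
  simp only [Finset.card_filter]
  rw [Finset.sum_comm, ← Finset.sum_add_distrib]
  refine Finset.sum_congr rfl fun U _ => ?_
  by_cases hU : U ≤ W ∧ gridDim F G U = D
  swap
  · have h1 : ¬ (U ≤ W ⊓ LinearMap.ker φ ∧ gridDim F G U = D) :=
      fun h => hU ⟨h.1.trans inf_le_left, h.2⟩
    have h2 : ∀ c : Fin n, ¬ (U ≤ W ∧ gridDim F G U = D ∧
        U ⊓ G.space c.castSucc ≤ LinearMap.ker φ ∧ ¬ U ⊓ G.space c.succ ≤ LinearMap.ker φ) :=
      fun c h => hU ⟨h.1, h.2.1⟩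
    rw [if_neg hU, if_neg h1, Finset.sum_eq_zero fun c _ => if_neg (h2 c), add_zero]
  have hmono : Monotone fun j => if U ⊓ G.space j ≤ LinearMap.ker φ then 0 else 1 := by
    intro i j hij
    dsimp only
    split_ifs with h1 h2 <;> first | omega | skip
    exact absurd ((inf_le_inf le_rfl (G.mono hij)).trans (by assumption)) h1
  have htele := sum_fin_tsub n _ hmono
  rw [G.space_zero, G.space_last, inf_bot_eq, inf_top_eq, if_pos bot_le, Nat.sub_zero] at htele
  have hterm : ∀ c : Fin n, (if U ≤ W ∧ gridDim F G U = D ∧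
        U ⊓ G.space c.castSucc ≤ LinearMap.ker φ ∧ ¬ U ⊓ G.space c.succ ≤ LinearMap.ker φ
      then 1 else 0) = (if U ⊓ G.space c.succ ≤ LinearMap.ker φ then 0 else 1) -
        (if U ⊓ G.space c.castSucc ≤ LinearMap.ker φ then 0 else 1) := by
    intro c
    by_cases h1 : U ⊓ G.space c.castSucc ≤ LinearMap.ker φ <;>
      by_cases h2 : U ⊓ G.space c.succ ≤ LinearMap.ker φ <;> simp [h1, h2, hU]
  rw [Finset.sum_congr rfl fun c _ => hterm c, htele, if_pos hU]
  by_cases h : U ≤ LinearMap.ker φ <;> simp [h, hU]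

variable [Finite k] [Module.Finite k V]

open Classical in
-- The number of extensions depends on `U'` only through its grid dimensions, which makes the fibres
-- of `U ↦ U ∩ ker φ` uniform.
theorem card_extensions_flag {b : Fin n} (hb : W ⊓ G.space b.castSucc ≤ LinearMap.ker φ)
    (hb' : ¬ W ⊓ G.space b.succ ≤ LinearMap.ker φ) {U' : Submodule k V}
    (hU' : U' ≤ W ⊓ LinearMap.ker φ) (j : Fin (n + 1)) :
    ((Finset.univ.filter fun U : Submodule k V => U ≤ W ∧ U ⊓ LinearMap.ker φ = U' ∧
      ¬ U ⊓ G.space j ≤ LinearMap.ker φ).card : ℤ) =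
      (extensionPoly b (gridDim F G (W ⊓ LinearMap.ker φ)) (gridDim F G U') j).eval
        (Nat.card k : ℤ) := by
  rw [extensionPoly]
  split_ifs with hj
  · have hX : ¬ W ⊓ G.space j ≤ LinearMap.ker φ := fun h => hb'
      ((inf_le_inf le_rfl (G.mono (Fin.castSucc_lt_iff_succ_le.mp hj))).trans h)
    have h := Submodule.card_extensions φ hU' inf_le_left hX
    rw [Nat.card_subtype_eq_card_filter] at h
    -- The extension count needs a test space inside `W`; replacing `Gⱼ` by `W ∩ Gⱼ` changes nothing
    -- for `U ≤ W`.
    have hfilter : (Finset.univ.filter fun U : Submodule k V => U ≤ W ∧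
        U ⊓ LinearMap.ker φ = U' ∧ ¬ U ⊓ G.space j ≤ LinearMap.ker φ) =
        Finset.univ.filter fun U : Submodule k V => U ≤ W ∧
        U ⊓ LinearMap.ker φ = U' ∧ ¬ U ⊓ (W ⊓ G.space j) ≤ LinearMap.ker φ := by
      refine Finset.filter_congr fun U _ => and_congr_right fun hU => ?_
      rw [← inf_assoc, inf_eq_left.mpr hU]
    rw [hfilter, h, gridDim_last_left, gridDim_last_left, inf_right_comm, ← inf_assoc,
      inf_eq_left.mpr (hU'.trans inf_le_left)]
    simp
  · rw [eval_zero, Nat.cast_eq_zero, Finset.card_eq_zero, Finset.filter_eq_empty_iff]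
    rintro U - ⟨hU, -, h⟩
    exact h ((inf_le_inf hU (G.mono (not_lt.mp hj))).trans hb)

open Classical in
theorem card_extensions_step {b : Fin n} (hb : W ⊓ G.space b.castSucc ≤ LinearMap.ker φ)
    (hb' : ¬ W ⊓ G.space b.succ ≤ LinearMap.ker φ) {U' : Submodule k V}
    (hU' : U' ≤ W ⊓ LinearMap.ker φ) (c : Fin n) :
    ((Finset.univ.filter fun U : Submodule k V => U ≤ W ∧ U ⊓ LinearMap.ker φ = U' ∧
      U ⊓ G.space c.castSucc ≤ LinearMap.ker φ ∧ ¬ U ⊓ G.space c.succ ≤ LinearMap.ker φ).card : ℤ) =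
      (extensionPoly b (gridDim F G (W ⊓ LinearMap.ker φ)) (gridDim F G U') c.succ -
        extensionPoly b (gridDim F G (W ⊓ LinearMap.ker φ)) (gridDim F G U') c.castSucc).eval
        (Nat.card k : ℤ) := by
  rw [eval_sub, ← card_extensions_flag F G W φ hb hb' hU', ← card_extensions_flag F G W φ hb hb' hU',
    eq_sub_iff_add_eq, ← Nat.cast_add, ← Finset.card_union_of_disjoint]
  · congr 2
    ext U
    have hmono : U ⊓ G.space c.castSucc ≤ U ⊓ G.space c.succ :=
      inf_le_inf le_rfl (G.castSucc_le_succ c)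
    have himp : U ⊓ G.space c.succ ≤ LinearMap.ker φ → U ⊓ G.space c.castSucc ≤ LinearMap.ker φ :=
      hmono.trans
    simp only [Finset.mem_union, Finset.mem_filter, Finset.mem_univ, true_and]
    tauto
  · rw [Finset.disjoint_filter]
    tauto

open Classical in
-- The subspaces are fibred over `U' = U ∩ ker φ`, whose grid dimensions are forced to be `D -
-- cornerDim a c`. The hypothesis `hc` makes the truncated subtraction reversible.
theorem card_subspaces_step {a b : Fin n} (ha : W ≤ F.space a.succ)
    (ha' : W ⊓ F.space a.castSucc ≤ LinearMap.ker φ)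
    (hb : W ⊓ G.space b.castSucc ≤ LinearMap.ker φ)
    (hb' : ¬ W ⊓ G.space b.succ ≤ LinearMap.ker φ) (D : Fin (n + 1) → Fin (n + 1) → ℕ)
    (c : Fin n) (hc : cornerDim a c ≤ D) :
    ((Finset.univ.filter fun U : Submodule k V => U ≤ W ∧ gridDim F G U = D ∧
      U ⊓ G.space c.castSucc ≤ LinearMap.ker φ ∧ ¬ U ⊓ G.space c.succ ≤ LinearMap.ker φ).card : ℤ) =
      (Finset.univ.filter fun U : Submodule k V => U ≤ W ⊓ LinearMap.ker φ ∧
        gridDim F G U = D - cornerDim a c).card *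
      (extensionPoly b (gridDim F G (W ⊓ LinearMap.ker φ)) (D - cornerDim a c) c.succ -
        extensionPoly b (gridDim F G (W ⊓ LinearMap.ker φ)) (D - cornerDim a c) c.castSucc).eval
        (Nat.card k : ℤ) := by
  have hdims : ∀ U : Submodule k V, U ≤ W → U ⊓ G.space c.castSucc ≤ LinearMap.ker φ →
      ¬ U ⊓ G.space c.succ ≤ LinearMap.ker φ →
      gridDim F G (U ⊓ LinearMap.ker φ) + cornerDim a c = gridDim F G U := by
    intro U hU h1 h2
    funext i j
    exact gridDim_inf_ker F G φ (hU.trans ha) ((inf_le_inf hU le_rfl).trans ha') h1 h2 i j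
  rw [Finset.card_eq_sum_card_fiberwise (f := fun U => U ⊓ LinearMap.ker φ)
    (t := Finset.univ.filter fun U : Submodule k V => U ≤ W ⊓ LinearMap.ker φ ∧
        gridDim F G U = D - cornerDim a c), Nat.cast_sum, Finset.sum_eq_card_nsmul, nsmul_eq_mul]
  · intro U' hU'
    simp only [Finset.mem_filter, Finset.mem_univ, true_and] at hU'
    rw [← hU'.2, ← card_extensions_step F G W φ hb hb' hU'.1, Finset.filter_filter]
    congr 2
    refine Finset.filter_congr fun U _ => ?_
    constructor
    · rintro ⟨⟨h1, -, h3, h4⟩, h5⟩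
      exact ⟨h1, h5, h3, h4⟩
    · rintro ⟨h1, h5, h3, h4⟩
      refine ⟨⟨h1, ?_, h3, h4⟩, h5⟩
      rw [← hdims U h1 h3 h4, h5, hU'.2, tsub_add_cancel_of_le hc]
  · intro U hU
    simp only [Finset.coe_filter, Finset.mem_univ, true_and, Set.mem_ofPred_eq] at hU ⊢
    obtain ⟨h1, h2, h3, h4⟩ := hU
    refine ⟨inf_le_inf h1 le_rfl, ?_⟩
    rw [← h2, ← hdims U h1 h3 h4, add_tsub_cancel_right]

end Fibres

open Classical in
-- Induction on `dim W`, the top entry of `E`. The indices `a` and `b` governing the hyperplane are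
-- read off from `E` alone, so one recursion serves all fields and all `W`.
theorem exists_isSubspaceCount (E D : Fin (n + 1) → Fin (n + 1) → ℕ) :
    ∃ P, IsSubspaceCount E D P := by
  obtain ⟨N, hN⟩ : ∃ N, E (Fin.last n) (Fin.last n) = N := ⟨_, rfl⟩
  induction N generalizing E D with
  | zero =>
    refine ⟨if D = 0 then 1 else 0, ?_⟩
    intro k V _ _ _ _ _ F G W hW
    rw [← hW, gridDim_last_last, Submodule.finrank_eq_zero] at hN
    subst hN
    have h0 : gridDim F G ⊥ = 0 := by
      funext i j
      rw [gridDim, bot_inf_eq, finrank_bot]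
      rfl
    split_ifs with hD
    · subst hD
      have : Unique {U : Submodule k V // U ≤ ⊥ ∧ gridDim F G U = 0} :=
        { default := ⟨⊥, le_rfl, h0⟩
          uniq := fun U => Subtype.ext (le_bot_iff.mp U.2.1) }
      rw [Nat.card_unique (α := {U : Submodule k V // U ≤ ⊥ ∧ gridDim F G U = 0}), eval_one,
        Nat.cast_one]
    · have : IsEmpty {U : Submodule k V // U ≤ ⊥ ∧ gridDim F G U = D} := by
        refine ⟨fun U => hD ?_⟩
        rw [← U.2.2, le_bot_iff.mp U.2.1, h0]
      rw [Nat.card_of_isEmpty (α := {U : Submodule k V // U ≤ ⊥ ∧ gridDim F G U = D}), eval_zero,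
        Nat.cast_zero]
  | succ N ih =>
    -- If `E` is nonzero on the border, no `W` realises it and any polynomial will do.
    by_cases hE : (∀ j, E 0 j = 0) ∧ ∀ i, E i 0 = 0
    swap
    · refine ⟨0, ?_⟩
      intro k V _ _ _ _ _ F G W hW
      subst hW
      exact absurd ⟨gridDim_zero_left F G W, gridDim_zero_right F G W⟩ hE
    -- At step `a` the spaces `W ∩ Fᵢ` reach `W`; at step `b` the sums `W ∩ F_a + W ∩ Gⱼ` do.
    obtain ⟨a, ha, ha'⟩ := Fin.exists_castSucc_succ_of_not
      (p := fun i => E i (Fin.last n) = E (Fin.last n) (Fin.last n))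
      (by rw [hE.1, hN]; omega) rfl
    obtain ⟨b, hb, hb'⟩ := Fin.exists_castSucc_succ_of_not
      (p := fun j => E a.castSucc (Fin.last n) + E (Fin.last n) j =
        E (Fin.last n) (Fin.last n) + E a.castSucc j)
      (by rw [hE.2, hE.2]; simpa using ha) (add_comm _ _)
    have hcorner : cornerDim a b (Fin.last n) (Fin.last n) = 1 :=
      if_pos ⟨Fin.castSucc_lt_last a, Fin.castSucc_lt_last b⟩
    choose Q hQ using fun D => ih (E - cornerDim a b) D (by
      rw [Pi.sub_apply, Pi.sub_apply, hN, hcorner, Nat.add_sub_cancel])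
    refine ⟨Q D + ∑ c : Fin n, if cornerDim a c ≤ D then Q (D - cornerDim a c) *
      (extensionPoly b (E - cornerDim a b) (D - cornerDim a c) c.succ -
        extensionPoly b (E - cornerDim a b) (D - cornerDim a c) c.castSucc) else 0, ?_⟩
    intro k V _ _ _ _ _ F G W hW
    have : Finite V := Module.finite_of_finite k
    have : Fintype (Submodule k V) := Fintype.ofFinite _
    obtain ⟨φ, h1, h2, h3, h4⟩ := exists_hyperplane F G W a b (by rw [hW]; exact ha')
      (by rw [hW]; exact hb') (by rw [hW]; exact hb)
    have hWK : gridDim F G (W ⊓ LinearMap.ker φ) = E - cornerDim a b := by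
      have : gridDim F G (W ⊓ LinearMap.ker φ) + cornerDim a b = E := by
        rw [← hW]
        funext i j
        exact gridDim_inf_ker F G φ h1 h2 h3 h4 i j
      rw [← this, add_tsub_cancel_right]
    have hcount : ∀ D', (Q D').eval (Nat.card k : ℤ) = ((Finset.univ.filter
        fun U : Submodule k V => U ≤ W ⊓ LinearMap.ker φ ∧ gridDim F G U = D').card : ℤ) := by
      intro D'
      rw [hQ D' k V F G _ hWK, Nat.card_subtype_eq_card_filter]
    rw [Nat.card_subtype_eq_card_filter, card_subspaces_eq_add_sum F G W φ D, eval_add, hcount,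
      Nat.cast_add, Nat.cast_sum, eval_finsetSum]
    congr 1
    refine Finset.sum_congr rfl fun c _ => ?_
    split_ifs with hc
    · rw [card_subspaces_step F G W φ h1 h2 h3 h4 D c hc, eval_mul, hcount, hWK]
    -- A subspace leaving the hyperplane at step `c` has grid dimensions at least `cornerDim a c`,
    -- so here there are none.
    · rw [eval_zero, eq_comm, Nat.cast_eq_zero, Finset.card_eq_zero, Finset.filter_eq_empty_iff]
      rintro U - ⟨hU, hD, h5, h6⟩
      refine hc fun i j => ?_
      rw [← hD, ← gridDim_inf_ker F G φ (hU.trans h1) ((inf_le_inf hU le_rfl).trans h2) h5 h6 i j]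
      exact Nat.le_add_left _ _

end Count

end StepFlag

/-! ### Chains of subspaces and existence of the structure polynomials -/

namespace StepFlag

section Chains

variable {k V : Type*} [Field k] [AddCommGroup V] [Module k V] {n m : ℕ}

/-- The grid dimensions `D` have last column `p` and last row `q`. -/
def HasMargins (D : Fin (n + 1) → Fin (n + 1) → ℕ) (p q : Fin (n + 1) → ℕ) : Prop :=
  (∀ i, D i (Fin.last n) = p i) ∧ ∀ j, D (Fin.last n) j = q j

/-- A chain of subspaces of `W` with prescribed intersection dimensions with two flags. -/
def IsChainIn (F G : StepFlag k V n) (W : Submodule k V) (P Q : Fin m → Fin (n + 1) → ℕ)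
    (f : Fin m → Submodule k V) : Prop :=
  Monotone f ∧ ∀ l, f l ≤ W ∧ HasMargins (gridDim F G (f l)) (P l) (Q l)

theorem isChainIn_snoc_iff (F G : StepFlag k V n) (W U : Submodule k V)
    (P Q : Fin (m + 1) → Fin (n + 1) → ℕ) (g : Fin m → Submodule k V) :
    IsChainIn F G W P Q (Fin.snoc (α := fun _ => Submodule k V) g U) ↔
      (U ≤ W ∧ HasMargins (gridDim F G U) (P (Fin.last m)) (Q (Fin.last m))) ∧
        IsChainIn F G U (fun l => P l.castSucc) (fun l => Q l.castSucc) g := by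
  constructor
  · rintro ⟨hmono, h⟩
    have hU := h (Fin.last m)
    rw [Fin.snoc_last] at hU
    refine ⟨hU, fun i j hij => ?_, fun l => ⟨?_, ?_⟩⟩
    · have := hmono (Fin.castSucc_le_castSucc_iff.mpr hij)
      rwa [Fin.snoc_castSucc, Fin.snoc_castSucc] at this
    · have := hmono (Fin.le_last l.castSucc)
      rwa [Fin.snoc_castSucc, Fin.snoc_last] at this
    · have := (h l.castSucc).2
      rwa [Fin.snoc_castSucc] at this
  · rintro ⟨hU, hmono, h⟩
    refine ⟨fun i j => ?_, fun l => ?_⟩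
    · induction j using Fin.lastCases with
      | last =>
        intro _
        rw [Fin.snoc_last]
        induction i using Fin.lastCases with
        | last => rw [Fin.snoc_last]
        | cast i => rw [Fin.snoc_castSucc]; exact (h i).1
      | cast j =>
        induction i using Fin.lastCases with
        | last => intro hij; exact absurd (Fin.castSucc_lt_last j) hij.not_gt
        | cast i =>
          intro hij
          rw [Fin.snoc_castSucc, Fin.snoc_castSucc]
          exact hmono (Fin.castSucc_le_castSucc_iff.mp hij)
    · induction l using Fin.lastCases with
      | last => rw [Fin.snoc_last]; exact hU
      | cast l => rw [Fin.snoc_castSucc]; exact ⟨(h l).1.trans hU.1, (h l).2⟩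

open Classical in
theorem card_isChainIn_succ [Fintype (Submodule k V)] (F G : StepFlag k V n) (W : Submodule k V)
    (P Q : Fin (m + 1) → Fin (n + 1) → ℕ) :
    Nat.card {f : Fin (m + 1) → Submodule k V // IsChainIn F G W P Q f} =
      ∑ U with U ≤ W, if HasMargins (gridDim F G U) (P (Fin.last m)) (Q (Fin.last m)) then
        Nat.card {g : Fin m → Submodule k V //
          IsChainIn F G U (fun l => P l.castSucc) (fun l => Q l.castSucc) g} else 0 := by
  let φ : (Σ U : {U : Submodule k V // U ≤ W ∧ HasMargins (gridDim F G U) (P (Fin.last m))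
        (Q (Fin.last m))}, {g : Fin m → Submodule k V //
          IsChainIn F G U (fun l => P l.castSucc) (fun l => Q l.castSucc) g}) →
      {f : Fin (m + 1) → Submodule k V // IsChainIn F G W P Q f} :=
    fun x => ⟨Fin.snoc (α := fun _ => Submodule k V) x.2.1 x.1.1,
      (isChainIn_snoc_iff F G W x.1.1 P Q x.2.1).mpr ⟨x.1.2, x.2.2⟩⟩
  have hφ : Function.Bijective φ := by
    constructor
    · rintro ⟨⟨U, hU⟩, ⟨g, hg⟩⟩ ⟨⟨U', hU'⟩, ⟨g', hg'⟩⟩ h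
      have h' : Fin.snoc (α := fun _ => Submodule k V) g U =
        Fin.snoc (α := fun _ => Submodule k V) g' U' := Subtype.ext_iff.mp h
      obtain ⟨rfl, rfl⟩ := Fin.snoc_injective2 h'
      rfl
    · rintro ⟨f, hf⟩
      have hs : Fin.snoc (α := fun _ => Submodule k V) (fun l : Fin m => f l.castSucc)
          (f (Fin.last m)) = f := Fin.snoc_init_self f
      have h := (isChainIn_snoc_iff F G W (f (Fin.last m)) P Q fun l => f l.castSucc).mp
        (by rw [hs]; exact hf)
      exact ⟨⟨⟨f (Fin.last m), h.1⟩, ⟨fun l => f l.castSucc, h.2⟩⟩, Subtype.ext hs⟩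
  rw [← Nat.card_eq_of_bijective φ hφ, Nat.card_sigma, ← Finset.sum_filter, Finset.filter_filter]
  exact (Finset.sum_subtype _ (fun U => by simp) fun U => Nat.card {g : Fin m → Submodule k V //
    IsChainIn F G U (fun l => P l.castSucc) (fun l => Q l.castSucc) g}).symm

end Chains

open Classical in
-- Induction on the length. Once the top member `U` is chosen, it takes over the role of `W`, and
-- the number of remaining chains depends only on the grid dimensions of `U`.
theorem exists_chain_count {n m : ℕ} (E : Fin (n + 1) → Fin (n + 1) → ℕ)
    (P Q : Fin m → Fin (n + 1) → ℕ) :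
    ∃ p : ℤ[X], ∀ (k V : Type) [Field k] [Finite k] [AddCommGroup V] [Module k V]
      [Module.Finite k V] (F G : StepFlag k V n) (W : Submodule k V), gridDim F G W = E →
        p.eval (Nat.card k : ℤ) =
          (Nat.card {f : Fin m → Submodule k V // IsChainIn F G W P Q f} : ℤ) := by
  induction m generalizing E with
  | zero =>
    refine ⟨1, ?_⟩
    intro k V _ _ _ _ _ F G W _
    have : Unique {f : Fin 0 → Submodule k V // IsChainIn F G W P Q f} :=
      { default := ⟨Fin.elim0, fun i => i.elim0, fun i => i.elim0⟩
        uniq := fun f => Subtype.ext (funext fun i => i.elim0) }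
    rw [Nat.card_unique (α := {f : Fin 0 → Submodule k V // IsChainIn F G W P Q f}), eval_one,
      Nat.cast_one]
  | succ m ih =>
    choose R hR using fun D => ih D (fun l => P l.castSucc) (fun l => Q l.castSucc)
    choose S hS using fun D => exists_isSubspaceCount E D
    -- Grid dimensions of subspaces of `W` are bounded by `dim W`, so a finite sum independent of
    -- the field covers all cases.
    let T : Finset (Fin (n + 1) → Fin (n + 1) → ℕ) := Fintype.piFinset fun _ =>
      Fintype.piFinset fun _ => Finset.range (E (Fin.last n) (Fin.last n) + 1)
    refine ⟨∑ D ∈ T, if HasMargins D (P (Fin.last m)) (Q (Fin.last m)) then S D * R D else 0, ?_⟩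
    intro k V _ _ _ _ _ F G W hW
    have : Finite V := Module.finite_of_finite k
    have : Fintype (Submodule k V) := Fintype.ofFinite _
    have hT : ∀ U ∈ Finset.univ.filter fun U : Submodule k V => U ≤ W, gridDim F G U ∈ T := by
      intro U hU
      simp only [T, Fintype.mem_piFinset, Finset.mem_range, Nat.lt_succ_iff]
      intro i j
      rw [← hW, gridDim_last_last]
      exact Submodule.finrank_mono (inf_le_left.trans (Finset.mem_filter.mp hU).2)
    rw [card_isChainIn_succ, ← Finset.sum_fiberwise_of_maps_to hT, Nat.cast_sum, eval_finsetSum]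
    refine Finset.sum_congr rfl fun D _ => ?_
    have hterm : ∀ U ∈ (Finset.univ.filter fun U : Submodule k V => U ≤ W).filter
        fun U => gridDim F G U = D,
        (((if HasMargins (gridDim F G U) (P (Fin.last m)) (Q (Fin.last m)) then
          Nat.card {g : Fin m → Submodule k V //
            IsChainIn F G U (fun l => P l.castSucc) (fun l => Q l.castSucc) g} else 0 : ℕ)) : ℤ) =
        if HasMargins D (P (Fin.last m)) (Q (Fin.last m)) then (R D).eval (Nat.card k : ℤ)
          else 0 := by
      intro U hU
      have hD := (Finset.mem_filter.mp hU).2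
      rw [hD, hR D k V F G U hD]
      split_ifs <;> simp
    rw [Nat.cast_sum, Finset.sum_congr rfl hterm, Finset.sum_const, nsmul_eq_mul]
    split_ifs
    · rw [eval_mul, hS D k V F G W hW, Nat.card_subtype_eq_card_filter, Finset.filter_filter]
    · simp

/-- The structure polynomials exist (Beilinson, Lusztig and MacPherson). -/
theorem exists_isStructurePolynomial {n r : ℕ} (A A' A'' : OrbitLabel n r) :
    ∃ p : ℤ[X], IsStructurePolynomial A A' A'' p := by
  -- The field `ℚ` is an arbitrary choice: flags over it realise the labels, so that matrix
  -- conditions become conditions on `infDim`.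
  have hr : Module.finrank ℚ (Fin r → ℚ) = r := Module.finrank_fin_fun ℚ
  obtain ⟨F₁, f₁, hA⟩ := exists_relMatrix_eq hr A
  obtain ⟨f₂, G₂, hA'⟩ := exists_relMatrix_eq hr A'
  obtain ⟨F₃, G₃, hA''⟩ := exists_relMatrix_eq hr A''
  obtain ⟨p, hp⟩ := exists_chain_count (infDim F₃ G₃) (fun l i => infDim F₁ f₁ i l)
    (fun l j => infDim f₂ G₂ l j)
  refine ⟨p, ?_⟩
  intro k _ _ F G hFG
  have hk : Module.finrank k (Fin r → k) = r := Module.finrank_fin_fun k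
  rw [← hA'', relMatrix_eq_iff] at hFG
  rw [hp k (Fin r → k) F G ⊤ (by funext i j; rw [gridDim, top_inf_eq]; exact hFG i j)]
  congr 1
  have hmargins : ∀ (U : Submodule k (Fin r → k)) (l : Fin (n + 1)),
      HasMargins (gridDim F G U) (fun i => infDim F₁ f₁ i l) (fun j => infDim f₂ G₂ l j) ↔
        (∀ i, Module.finrank k ↥(F.space i ⊓ U) = infDim F₁ f₁ i l) ∧
          ∀ j, Module.finrank k ↥(U ⊓ G.space j) = infDim f₂ G₂ l j := by
    intro U l
    simp only [HasMargins, gridDim_last_left, gridDim_last_right]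
    exact and_congr_left' (forall_congr' fun i => by rw [inf_comm])
  -- The margins fix the dimension of each member, so the two ends of the chain are automatically
  -- `⊥` and `⊤`.
  have hdim : ∀ f : Fin (n + 1) → Submodule k (Fin r → k),
      IsChainIn F G ⊤ (fun l i => infDim F₁ f₁ i l) (fun l j => infDim f₂ G₂ l j) f →
        ∀ l, Module.finrank k (f l) = f₁.dimVec l := by
    intro f hf l
    have h := ((hmargins _ l).mp (hf.2 l).2).1 (Fin.last n)
    rwa [F.space_last, top_inf_eq, infDim_last_left] at h
  refine Nat.card_congr
    { toFun := fun f => ⟨⟨f.1, f.2.1, ?_, ?_⟩, ?_⟩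
      invFun := fun f => ⟨f.1.space, f.1.mono, fun l => ⟨le_top, (hmargins _ l).mpr ⟨?_, ?_⟩⟩⟩
      left_inv := fun f => rfl
      right_inv := fun f => rfl }
  · rw [← Submodule.finrank_eq_zero, hdim f.1 f.2, dimVec, f₁.space_zero, finrank_bot]
  · refine Submodule.eq_top_of_finrank_eq ?_
    rw [hdim f.1 f.2, dimVec, f₁.space_last, finrank_top, hr, hk]
  · rw [← hA, ← hA', relMatrix_eq_iff, relMatrix_eq_iff]
    exact ⟨fun i l => ((hmargins _ l).mp (f.2.2 l).2).1 i,
      fun l j => ((hmargins _ l).mp (f.2.2 l).2).2 j⟩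
  · exact fun i => (relMatrix_eq_iff _ _ _ _).mp (f.2.1.trans hA.symm) i l
  · exact fun j => (relMatrix_eq_iff _ _ _ _).mp (f.2.2.trans hA'.symm) l j

theorem isStructurePolynomial_structurePolynomial {n r : ℕ} (A A' A'' : OrbitLabel n r) :
    IsStructurePolynomial A A' A'' (structurePolynomial A A' A'') := by
  have h := exists_isStructurePolynomial A A' A''
  rw [structurePolynomial, dif_pos h]
  exact h.choose_spec

end StepFlag

/-! ### Sums of flags and the leading structure constants -/

namespace StepFlag

section Sup

variable {k V : Type*} [Field k] [AddCommGroup V] [Module k V] {n : ℕ}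

theorem sup_space (f g : StepFlag k V n) (i : Fin (n + 1)) :
    (f ⊔ g).space i = f.space i ⊔ g.space i := rfl

theorem sup_comm' (f g : StepFlag k V n) : f ⊔ g = g ⊔ f :=
  StepFlag.ext (funext fun i => sup_comm (f.space i) (g.space i))

theorem infDim_sup_of_le (f g : StepFlag k V n) {i j : Fin (n + 1)} (h : i ≤ j) :
    infDim f (f ⊔ g) i j = f.dimVec i := by
  rw [infDim, sup_space, inf_eq_left.mpr ((f.mono h).trans le_sup_left), dimVec]

theorem infDim_self_sup (f g : StepFlag k V n) (i : Fin (n + 1)) :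
    infDim f (f ⊔ g) i i = f.dimVec i :=
  infDim_sup_of_le f g le_rfl

theorem infDim_sup_comm (f g : StepFlag k V n) (i j : Fin (n + 1)) :
    infDim (f ⊔ g) g i j = infDim g (g ⊔ f) j i := by
  rw [infDim_comm, sup_comm']

variable {K W : Type*} [Field K] [AddCommGroup W] [Module K W]

theorem dimVec_eq_of_infDim_eq {f₁ f : StepFlag k V n} {g₁ g : StepFlag K W n}
    (h : ∀ i j, infDim g₁ g i j = infDim f₁ f i j) : g.dimVec = f.dimVec := by
  funext i
  rw [← infDim_last_left g₁, h, infDim_last_left]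

variable [Module.Finite K W]

/-- A flag in the same relative position to `g₁` and `g₂` as `f₁ + f₂` is to `f₁` and `f₂` contains
`g₁ + g₂`. -/
theorem sup_le_of_infDim_eq {f₁ f₂ : StepFlag k V n} {g₁ g g₂ : StepFlag K W n}
    (h1 : ∀ i j, infDim g₁ g i j = infDim f₁ (f₁ ⊔ f₂) i j)
    (h2 : ∀ i j, infDim g g₂ i j = infDim (f₁ ⊔ f₂) f₂ i j) (i : Fin (n + 1)) :
    (g₁ ⊔ g₂).space i ≤ g.space i := by
  refine sup_le ?_ ?_
  -- Containment amounts to `dim (g₁ ∩ g)ᵢ = dim (g₁)ᵢ`, an equality between numbers that the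
  -- relative position prescribes.
  · rw [← inf_eq_left]
    refine Submodule.eq_of_le_of_finrank_eq inf_le_left ?_
    change infDim g₁ g i i = g₁.dimVec i
    rw [h1, infDim_self_sup, ← infDim_last_right f₁ (f₁ ⊔ f₂), ← h1, infDim_last_right]
  · rw [← inf_eq_right]
    refine Submodule.eq_of_le_of_finrank_eq inf_le_right ?_
    change infDim g g₂ i i = g₂.dimVec i
    rw [h2, infDim_sup_comm, infDim_self_sup, ← infDim_last_left (f₁ ⊔ f₂) f₂, ← h2,
      infDim_last_left]

variable [Module.Finite k V]

theorem dimVec_sup_add (f g : StepFlag k V n) (i : Fin (n + 1)) :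
    (f ⊔ g).dimVec i + infDim f g i i = f.dimVec i + g.dimVec i :=
  Submodule.finrank_sup_add_finrank_inf_eq (f.space i) (g.space i)

/-- For `j ≤ i` the modular law gives `Fᵢ ∩ (Fⱼ + Gⱼ) = Fⱼ + Fᵢ ∩ Gⱼ`, and the two summands meet in
`Fⱼ ∩ Gⱼ`. -/
theorem infDim_sup_add (f g : StepFlag k V n) {i j : Fin (n + 1)} (h : j ≤ i) :
    infDim f (f ⊔ g) i j + infDim f g j j = f.dimVec j + infDim f g i j := by
  have h1 := Submodule.finrank_sup_add_finrank_inf_eq (f.space j) (f.space i ⊓ g.space j)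
  rw [← inf_assoc, inf_eq_left.mpr (f.mono h), inf_comm (f.space i),
    ← sup_inf_assoc_of_le _ (f.mono h), inf_comm _ (f.space i), inf_comm (g.space j)] at h1
  exact h1

theorem infDim_sup_congr {f₁ f₂ : StepFlag k V n} {g₁ g₂ : StepFlag K W n}
    (h : ∀ i j, infDim f₁ f₂ i j = infDim g₁ g₂ i j) (i j : Fin (n + 1)) :
    infDim f₁ (f₁ ⊔ f₂) i j = infDim g₁ (g₁ ⊔ g₂) i j := by
  have hdim : ∀ i, f₁.dimVec i = g₁.dimVec i := fun i => by
    rw [← infDim_last_right f₁ f₂, h, infDim_last_right]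
  rcases le_total i j with hij | hij
  · rw [infDim_sup_of_le _ _ hij, infDim_sup_of_le _ _ hij, hdim]
  · have h1 := infDim_sup_add f₁ f₂ hij
    have h2 := infDim_sup_add g₁ g₂ hij
    rw [h, h, hdim] at h1
    omega

theorem dimVec_sup_congr {f₁ f₂ : StepFlag k V n} {g₁ g₂ : StepFlag K W n}
    (h : ∀ i j, infDim f₁ f₂ i j = infDim g₁ g₂ i j) : (f₁ ⊔ f₂).dimVec = (g₁ ⊔ g₂).dimVec := by
  funext j
  rw [← infDim_last_left f₁, ← infDim_last_left g₁, infDim_sup_congr h]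

/-- The relative positions of `f₁` and `f₂` with respect to `f₁ + f₂` determine each other and the
relative position of `f₁` and `f₂`, even across different fields. -/
theorem infDim_sup_iff (f₁ f₂ : StepFlag k V n) (g₁ g₂ : StepFlag K W n) :
    ((∀ i j, infDim f₁ (f₁ ⊔ f₂) i j = infDim g₁ (g₁ ⊔ g₂) i j) ∧
      ∀ i j, infDim (f₁ ⊔ f₂) f₂ i j = infDim (g₁ ⊔ g₂) g₂ i j) ↔
      ∀ i j, infDim f₁ f₂ i j = infDim g₁ g₂ i j := by
  constructor
  · rintro ⟨h1, h2⟩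
    have hdim : ∀ i, (f₁ ⊔ f₂).dimVec i = (g₁ ⊔ g₂).dimVec i := fun i => by
      rw [← infDim_last_left f₁, h1, infDim_last_left]
    have hdim1 : ∀ i, f₁.dimVec i = g₁.dimVec i := fun i => by
      rw [← infDim_last_right f₁ (f₁ ⊔ f₂), h1, infDim_last_right]
    have hdim2 : ∀ i, f₂.dimVec i = g₂.dimVec i := fun i => by
      rw [← infDim_last_left (f₁ ⊔ f₂) f₂, h2, infDim_last_left]
    -- The diagonal comes from the dimension formula for `f₁ + f₂`. Entries with `j ≤ i` then follow
    -- from the position of `f₁` relative to the sum, the others from that of `f₂`.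
    have hdiag : ∀ i, infDim f₁ f₂ i i = infDim g₁ g₂ i i := fun i => by
      have e1 := dimVec_sup_add f₁ f₂ i
      have e2 := dimVec_sup_add g₁ g₂ i
      rw [hdim, hdim1, hdim2] at e1
      omega
    intro i j
    rcases le_total j i with hij | hij
    · have e1 := infDim_sup_add f₁ f₂ hij
      have e2 := infDim_sup_add g₁ g₂ hij
      rw [h1, hdiag, hdim1] at e1
      omega
    · have e1 := infDim_sup_add f₂ f₁ hij
      have e2 := infDim_sup_add g₂ g₁ hij
      rw [← infDim_sup_comm, h2, infDim_comm f₂ f₁, infDim_comm f₂ f₁, hdiag, hdim2] at e1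
      rw [← infDim_sup_comm, infDim_comm g₂ g₁, infDim_comm g₂ g₁] at e2
      omega
  · intro h
    refine ⟨infDim_sup_congr h, fun i j => ?_⟩
    rw [infDim_sup_comm, infDim_sup_comm]
    refine infDim_sup_congr (fun i j => ?_) j i
    rw [infDim_comm, h, infDim_comm]

theorem eq_of_space_le_of_dimVec_eq {f g : StepFlag k V n} (h : ∀ i, f.space i ≤ g.space i)
    (hd : f.dimVec = g.dimVec) : f = g :=
  StepFlag.ext (funext fun i => Submodule.eq_of_le_of_finrank_eq (h i) (congrFun hd i))

end Sup

theorem _root_.Polynomial.eq_of_eval_natCard_eq {P Q : ℤ[X]}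
    (h : ∀ (k : Type) [Field k] [Finite k],
      P.eval (Nat.card k : ℤ) = Q.eval (Nat.card k : ℤ)) : P = Q := by
  refine Polynomial.eq_of_infinite_eval_eq P Q
    ((Nat.infinite_setOfPred_prime.image (Nat.cast_injective (R := ℤ)).injOn).mono ?_)
  rintro _ ⟨p, hp, rfl⟩
  have : Fact p.Prime := ⟨hp⟩
  have hk := h (ZMod p)
  rw [Nat.card_zmod] at hk
  exact hk

section StructureConstants

variable {k V : Type*} [Field k] [AddCommGroup V] [Module k V] [Module.Finite k V] {n r : ℕ}
  (hV : Module.finrank k V = r)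

/-- Over each finite field the only intermediate flag is `g₁ + g₂`: any other would contain it and
have the same dimensions. -/
theorem structurePolynomial_sup_eq_one (f₁ f₂ : StepFlag k V n) :
    structurePolynomial (label hV f₁ (f₁ ⊔ f₂)) (label hV (f₁ ⊔ f₂) f₂) (label hV f₁ f₂) = 1 := by
  refine Polynomial.eq_of_eval_natCard_eq fun K _ _ => ?_
  have hK : Module.finrank K (Fin r → K) = r := Module.finrank_fin_fun K
  obtain ⟨g₁, g₂, hg⟩ := exists_relMatrix_eq hK (label hV f₁ f₂)
  rw [isStructurePolynomial_structurePolynomial _ _ _ K g₁ g₂ hg, eval_one]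
  replace hg := (relMatrix_eq_iff g₁ g₂ f₁ f₂).mp hg
  have hsup := (infDim_sup_iff g₁ g₂ f₁ f₂).mpr hg
  have : Unique {g : StepFlag K (Fin r → K) n // g₁.relMatrix g = (label hV f₁ (f₁ ⊔ f₂)).1 ∧
      g.relMatrix g₂ = (label hV (f₁ ⊔ f₂) f₂).1} :=
    { default := ⟨g₁ ⊔ g₂, (relMatrix_eq_iff _ _ _ _).mpr hsup.1,
        (relMatrix_eq_iff _ _ _ _).mpr hsup.2⟩
      uniq := fun g => by
        have h1 := (relMatrix_eq_iff _ _ _ _).mp g.2.1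
        have h2 := (relMatrix_eq_iff _ _ _ _).mp g.2.2
        refine Subtype.ext (eq_of_space_le_of_dimVec_eq (sup_le_of_infDim_eq h1 h2) ?_).symm
        rw [dimVec_eq_of_infDim_eq h1, dimVec_sup_congr hg] }
  rw [Nat.card_unique, Nat.cast_one]

/-- A nonzero coefficient yields an intermediate flag over some finite field. It contains the sum of
the outer flags; if the dimensions agreed it would equal that sum, and the labels would coincide. -/
theorem dimVec_sup_lt_of_structurePolynomial_ne_zero (f₁ f₂ g₁ g₂ : StepFlag k V n)
    (hne : label hV g₁ g₂ ≠ label hV f₁ f₂)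
    (h : structurePolynomial (label hV f₁ (f₁ ⊔ f₂)) (label hV (f₁ ⊔ f₂) f₂) (label hV g₁ g₂) ≠ 0) :
    (g₁ ⊔ g₂).dimVec < (f₁ ⊔ f₂).dimVec := by
  by_contra hlt
  refine h (Polynomial.eq_of_eval_natCard_eq fun K _ _ => ?_)
  have hK : Module.finrank K (Fin r → K) = r := Module.finrank_fin_fun K
  obtain ⟨h₁, h₂, hh⟩ := exists_relMatrix_eq hK (label hV g₁ g₂)
  rw [isStructurePolynomial_structurePolynomial _ _ _ K h₁ h₂ hh, eval_zero]
  replace hh := (relMatrix_eq_iff h₁ h₂ g₁ g₂).mp hh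
  have : IsEmpty {g : StepFlag K (Fin r → K) n // h₁.relMatrix g = (label hV f₁ (f₁ ⊔ f₂)).1 ∧
      g.relMatrix h₂ = (label hV (f₁ ⊔ f₂) f₂).1} := by
    refine ⟨fun g => ?_⟩
    have e1 := (relMatrix_eq_iff _ _ _ _).mp g.2.1
    have e2 := (relMatrix_eq_iff _ _ _ _).mp g.2.2
    have hle := sup_le_of_infDim_eq e1 e2
    have hdim : (h₁ ⊔ h₂).dimVec = (f₁ ⊔ f₂).dimVec := by
      have hle' : (h₁ ⊔ h₂).dimVec ≤ (f₁ ⊔ f₂).dimVec := by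
        rw [← dimVec_eq_of_infDim_eq e1]
        exact fun i => Submodule.finrank_mono (hle i)
      rw [← dimVec_sup_congr hh] at hlt
      exact hle'.eq_of_not_lt hlt
    have hg : h₁ ⊔ h₂ = g.1 :=
      eq_of_space_le_of_dimVec_eq hle (hdim.trans (dimVec_eq_of_infDim_eq e1).symm)
    rw [← hg] at e1 e2
    refine hne ((label_eq_iff hV hV _ _ _ _).mpr fun i j => ?_)
    rw [← hh]
    exact (infDim_sup_iff h₁ h₂ f₁ f₂).mp ⟨e1, e2⟩ i j
  rw [Nat.card_of_isEmpty, Nat.cast_zero]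

end StructureConstants

end StepFlag

/-! ### Unitriangularity and the basis -/

namespace QSchur

open StepFlag

variable {k V : Type*} [Field k] [AddCommGroup V] [Module k V] [Module.Finite k V] {n r : ℕ}
  (hV : Module.finrank k V = r)

/-- The product `[f₁, f₁ + f₂] [f₁ + f₂, f₂]`. -/
noncomputable def orbProd (f₁ f₂ : StepFlag k V n) : QSchur n r :=
  orb hV f₁ (f₁ ⊔ f₂) * orb hV (f₁ ⊔ f₂) f₂

theorem exists_label_eq {k V : Type*} [Field k] [AddCommGroup V] [Module k V] [Module.Finite k V]
    {n r : ℕ} (hV : Module.finrank k V = r) (A : OrbitLabel n r) :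
    ∃ f₁ f₂ : StepFlag k V n, label hV f₁ f₂ = A := by
  obtain ⟨f₁, f₂, h⟩ := exists_relMatrix_eq hV A
  exact ⟨f₁, f₂, Subtype.ext h⟩

theorem orbProd_sub_mem_span (f₁ f₂ : StepFlag k V n) :
    orbProd hV f₁ f₂ - orb hV f₁ f₂ ∈
      Submodule.span ℤ[X] {x : QSchur n r | ∃ g₁ g₂ : StepFlag k V n,
        (g₁ ⊔ g₂).dimVec < (f₁ ⊔ f₂).dimVec ∧ x = orb hV g₁ g₂} := by
  rw [orbProd, orb, orb, orb, e_mul_e, ← Finset.add_sum_erase _ _ (Finset.mem_univ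
    (label hV f₁ f₂)), structurePolynomial_sup_eq_one, one_smul, add_sub_cancel_left]
  refine Submodule.sum_mem _ fun C hC => ?_
  obtain ⟨g₁, g₂, rfl⟩ := exists_label_eq hV C
  by_cases h : structurePolynomial (label hV f₁ (f₁ ⊔ f₂)) (label hV (f₁ ⊔ f₂) f₂)
      (label hV g₁ g₂) = 0
  · rw [h, zero_smul]
    exact Submodule.zero_mem _
  · exact Submodule.smul_mem _ _ (Submodule.subset_span ⟨g₁, g₂,
      dimVec_sup_lt_of_structurePolynomial_ne_zero hV f₁ f₂ g₁ g₂ (Finset.ne_of_mem_erase hC) h,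
      rfl⟩)

theorem orbProd_congr {f₁ f₂ g₁ g₂ : StepFlag k V n} (h : pairOrbit f₁ f₂ = pairOrbit g₁ g₂) :
    orbProd hV f₁ f₂ = orbProd hV g₁ g₂ := by
  rw [pairOrbit_eq_iff, relMatrix_eq_iff, ← infDim_sup_iff, ← label_eq_iff hV hV,
    ← label_eq_iff hV hV] at h
  rw [orbProd, orbProd, orb, orb, orb, orb, h.1, h.2]

/-- Inversion of the unitriangular relation, by well-founded induction on the dimension vector of
`f₁ + f₂`. -/
theorem orb_mem_span_orbProd (f₁ f₂ : StepFlag k V n) :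
    orb hV f₁ f₂ ∈ Submodule.span ℤ[X] {x : QSchur n r | ∃ g₁ g₂ : StepFlag k V n,
      x = orbProd hV g₁ g₂} := by
  obtain ⟨d, hd⟩ : ∃ d, (f₁ ⊔ f₂).dimVec = d := ⟨_, rfl⟩
  induction d using WellFoundedLT.induction generalizing f₁ f₂ with
  | ind d ih =>
    subst hd
    rw [← sub_sub_cancel (orbProd hV f₁ f₂) (orb hV f₁ f₂)]
    refine Submodule.sub_mem _ (Submodule.subset_span ⟨f₁, f₂, rfl⟩)
      (Submodule.span_le.mpr ?_ (orbProd_sub_mem_span hV f₁ f₂))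
    rintro _ ⟨g₁, g₂, hlt, rfl⟩
    exact ih _ hlt g₁ g₂ rfl

theorem span_range_e (n r : ℕ) :
    Submodule.span ℤ[X] (Set.range (e : OrbitLabel n r → QSchur n r)) = ⊤ := by
  have h := (Pi.basisFun ℤ[X] (OrbitLabel n r)).span_eq
  have he : ⇑(Pi.basisFun ℤ[X] (OrbitLabel n r)) = (e : OrbitLabel n r → QSchur n r) := by
    funext A
    rw [Pi.basisFun_apply]
    rfl
  rw [he] at h
  exact h

theorem finrank_eq_card (n r : ℕ) :
    Module.finrank ℤ[X] (QSchur n r) = Fintype.card (OrbitLabel n r) :=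
  Module.finrank_fintype_fun_eq_card (η := OrbitLabel n r) ℤ[X]

/-- The bijection between orbits of pairs of flags and matrices. -/
noncomputable def pairOrbitEquiv : PairOrbit k V n ≃ OrbitLabel n r :=
  Equiv.ofBijective
    (Quotient.lift (fun p : StepFlag k V n × StepFlag k V n => label hV p.1 p.2)
      fun p q h => Subtype.ext ((pairOrbit_eq_iff p.1 p.2 q.1 q.2).mp (Quotient.sound h)))
    (by
      constructor
      · intro x y
        induction x using Quotient.inductionOn with | h p => ?_
        induction y using Quotient.inductionOn with | h q => ?_
        intro h
        exact (pairOrbit_eq_iff p.1 p.2 q.1 q.2).mpr (Subtype.ext_iff.mp h)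
      · intro A
        obtain ⟨f₁, f₂, h⟩ := exists_label_eq hV A
        exact ⟨pairOrbit f₁ f₂, h⟩)

/-- Over a commutative ring a spanning family with as many members as the rank is a basis, so linear
independence needs no separate argument. -/
theorem exists_basis_orbProd : ∃ b : Module.Basis (PairOrbit k V n) ℤ[X] (QSchur n r),
    ∀ f₁ f₂ : StepFlag k V n, b (pairOrbit f₁ f₂) = orbProd hV f₁ f₂ := by
  let : Fintype (PairOrbit k V n) := Fintype.ofEquiv _ (pairOrbitEquiv hV).symm
  let v : PairOrbit k V n → QSchur n r := fun x => orbProd hV x.out.1 x.out.2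
  have hv : ∀ f₁ f₂ : StepFlag k V n, v (pairOrbit f₁ f₂) = orbProd hV f₁ f₂ :=
    fun f₁ f₂ => orbProd_congr hV (Quotient.out_eq (pairOrbit f₁ f₂))
  have htop : ⊤ ≤ Submodule.span ℤ[X] (Set.range v) := by
    rw [← span_range_e, Submodule.span_le]
    rintro _ ⟨A, rfl⟩
    obtain ⟨f₁, f₂, rfl⟩ := exists_label_eq hV A
    refine Submodule.span_mono ?_ (orb_mem_span_orbProd hV f₁ f₂)
    rintro _ ⟨g₁, g₂, rfl⟩
    exact ⟨pairOrbit g₁ g₂, hv g₁ g₂⟩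
  refine ⟨basisOfTopLeSpanOfCardEqFinrank v htop ?_, fun f₁ f₂ => ?_⟩
  · rw [finrank_eq_card, Fintype.card_congr (pairOrbitEquiv hV)]
  · rw [coe_basisOfTopLeSpanOfCardEqFinrank, hv]

end QSchur

/-- That the product depends only on the orbit is contained in the existence of `b`. In the product
order on `Fin (n + 1) → ℕ`, `<` means `≤` in every component and strict inequality in at least one.
-/
theorem theorem4p2 (n r : ℕ) (hn : 1 ≤ n) (hr : 1 ≤ r)
    (k V : Type*) [Field k] [AddCommGroup V] [Module k V] [Module.Finite k V]
    (hV : Module.finrank k V = r) :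
    (∃ b : Module.Basis (StepFlag.PairOrbit k V n) ℤ[X] (QSchur n r),
      ∀ f₁ f₂ : StepFlag k V n,
        b (StepFlag.pairOrbit f₁ f₂) =
          QSchur.orb hV f₁ (f₁ ⊔ f₂) * QSchur.orb hV (f₁ ⊔ f₂) f₂) ∧
    ∀ f₁ f₂ : StepFlag k V n,
      QSchur.orb hV f₁ (f₁ ⊔ f₂) * QSchur.orb hV (f₁ ⊔ f₂) f₂ - QSchur.orb hV f₁ f₂ ∈
        Submodule.span ℤ[X] {x : QSchur n r | ∃ g₁ g₂ : StepFlag k V n,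
          (g₁ ⊔ g₂).dimVec < (f₁ ⊔ f₂).dimVec ∧ x = QSchur.orb hV g₁ g₂} :=
  ⟨QSchur.exists_basis_orbProd hV, QSchur.orbProd_sub_mem_span hV⟩
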